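/- Let $n\ge 1$ be an integer. For $s\in\mathbb{R}$ let $H^s(\mathbb{R}^n)$ be the Bessel potential Sobolev space of all tempered distributions $u$ on $\mathbb{R}^n$ with $(1+|\xi|^2)^{s/2}\hat u\in L^2(\mathbb{R}^n)$, normed by $\|u\|_{H^s}=\|(1+|\xi|^2)^{s/2}\hat u\|_{L^2}$ (a different normalization of the Fourier transform gives the same space with an equivalent norm). For an open set $\Omega\subset\mathbb{R}^n$ consider the following subspaces of $H^s(\mathbb{R}^n)$: - $\widetilde H^s(\Omega)$, the closure in $H^s(\mathbb{R}^n)$ of the set of all smooth functions with compact support contained in $\Omega$; - $H^s_{\overline\Omega}$, the set of all $u\in H^s(\mathbb{R}^n)$ whose distributional support is contained in $\overline\Omega$; - for $s\ge 0$, $\mathring H^s(\Omega)$, the set of all $u\in H^s(\mathbb{R}^n)\subset L^2(\mathbb{R}^n)$ that vanish almost everywhere in $\mathbb{R}^n\setminus\Omega$. Then for every $n\ge 1$ there exists a bounded open set $\Omega\subset\mathbb{R}^n$ such that $$\widetilde H^s(\Omega)\subsetneqq \mathring H^s(\Omega)\subsetneqq H^s_{\overline\Omega}\qquad\text{for every }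 s>0,$$ and $$\widetilde H^s(\Omega)\subsetneqq H^s_{\overline\Omega}\qquad\text{for every } s\ge -\tfrac n2 .$$ -/

import Mathlib

open MeasureTheory TemperedDistribution Distribution
open scoped SchwartzMap

noncomputable section

/-- The Sobolev space `H^s(ℝⁿ)` as a linear subspace of the space of tempered distributions: all
`u` for which the Bessel potential `𝓕⁻¹ (1 + |ξ|²)^(s/2) 𝓕 u` is an `L²` function. -/
def sobolevSubmodule (n : ℕ) (s : ℝ) : Submodule ℂ 𝓢'(EuclideanSpace ℝ (Fin n), ℂ) where
  carrier := {u | MemSobolev s 2 u}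
  add_mem' := fun hu hv => hu.add hv
  zero_mem' := memSobolev_fun_zero (EuclideanSpace ℝ (Fin n)) ℂ s 2
  smul_mem' := fun c _ hu => hu.smul c

/-- The Sobolev space `H^s(ℝⁿ)`, as a type of its own: its topology is the one of the `H^s` norm
below, not the one inherited from tempered distributions. -/
def SobolevSpace (n : ℕ) (s : ℝ) : Type := sobolevSubmodule n s

namespace SobolevSpace

variable {n : ℕ} {s : ℝ}

instance : AddCommGroup (SobolevSpace n s) :=
  inferInstanceAs (AddCommGroup (sobolevSubmodule n s))

instance : Module ℂ (SobolevSpace n s) :=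
  inferInstanceAs (Module ℂ (sobolevSubmodule n s))

/-- The inclusion of `H^s(ℝⁿ)` into the tempered distributions. -/
def toDistribution : SobolevSpace n s →ₗ[ℂ] 𝓢'(EuclideanSpace ℝ (Fin n), ℂ) :=
  (sobolevSubmodule n s).subtype

theorem toDistribution_injective :
    Function.Injective (toDistribution : SobolevSpace n s →ₗ[ℂ] _) :=
  Subtype.val_injective

theorem memSobolev (u : SobolevSpace n s) : MemSobolev s 2 (toDistribution u) := u.2

theorem lp_toTemperedDistribution_injective :
    Function.Injective (fun f : Lp ℂ 2 (volume : Measure (EuclideanSpace ℝ (Fin n))) =>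
      (f : 𝓢'(EuclideanSpace ℝ (Fin n), ℂ))) := by
  have h := Lp.ker_toTemperedDistributionCLM_eq_bot (F := ℂ)
    (μ := (volume : Measure (EuclideanSpace ℝ (Fin n)))) (p := 2)
  exact LinearMap.ker_eq_bot.mp h

/-- The `L²` function that represents the Bessel potential of order `s` of `u ∈ H^s(ℝⁿ)`. -/
def besselRep (u : SobolevSpace n s) : Lp ℂ 2 (volume : Measure (EuclideanSpace ℝ (Fin n))) :=
  (memSobolev u).choose

theorem besselRep_spec (u : SobolevSpace n s) :
    besselPotential (EuclideanSpace ℝ (Fin n)) ℂ s (toDistribution u) = besselRep u :=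
  (memSobolev u).choose_spec

/-- The Bessel potential of order `s`, as a linear map from `H^s(ℝⁿ)` to `L²(ℝⁿ)`. -/
def besselLp : SobolevSpace n s →ₗ[ℂ] Lp ℂ 2 (volume : Measure (EuclideanSpace ℝ (Fin n))) where
  toFun := besselRep
  map_add' u v := by
    apply lp_toTemperedDistribution_injective
    have h := besselRep_spec (u + v)
    rw [map_add, map_add, besselRep_spec, besselRep_spec] at h
    simp only [← Lp.toTemperedDistributionCLM_apply, map_add] at h ⊢
    exact h.symm
  map_smul' c u := by
    apply lp_toTemperedDistribution_injective
    have h := besselRep_spec (c • u)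
    rw [map_smul, map_smul, besselRep_spec] at h
    simp only [← Lp.toTemperedDistributionCLM_apply, map_smul, RingHom.id_apply] at h ⊢
    exact h.symm

theorem besselPotential_toDistribution (u : SobolevSpace n s) :
    besselPotential (EuclideanSpace ℝ (Fin n)) ℂ s (toDistribution u) = besselLp u :=
  besselRep_spec u

theorem besselLp_injective : Function.Injective (besselLp : SobolevSpace n s →ₗ[ℂ] _) := by
  intro u v h
  apply toDistribution_injective
  have hu := besselPotential_toDistribution u
  rw [h, ← besselPotential_toDistribution v] at hu
  have := congrArg (besselPotential (EuclideanSpace ℝ (Fin n)) ℂ (-s)) hu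
  simpa using this

/-- The `H^s` norm is the `L²` norm of the Bessel potential of order `s`. -/
instance : NormedAddCommGroup (SobolevSpace n s) :=
  NormedAddCommGroup.induced (SobolevSpace n s) _ besselLp besselLp_injective

instance : NormedSpace ℂ (SobolevSpace n s) :=
  NormedSpace.induced ℂ (SobolevSpace n s) _ besselLp

theorem norm_eq (u : SobolevSpace n s) : ‖u‖ = ‖besselLp u‖ := rfl

/-- The subspace `𝓓(Ω)` of `H^s(ℝⁿ)`: smooth functions with compact support contained in `Ω`. -/
def testFunctions (s : ℝ) (Ω : Set (EuclideanSpace ℝ (Fin n))) :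
    Submodule ℂ (SobolevSpace n s) where
  carrier := {u | ∃ φ : 𝓢(EuclideanSpace ℝ (Fin n), ℂ), HasCompactSupport φ ∧ tsupport φ ⊆ Ω ∧
    toDistribution u = (φ : 𝓢'(EuclideanSpace ℝ (Fin n), ℂ))}
  add_mem' := by
    rintro u v ⟨φ, hφ, hφ', hu⟩ ⟨ψ, hψ, hψ', hv⟩
    refine ⟨φ + ψ, hφ.add hψ, ?_, by rw [map_add, map_add, hu, hv]⟩
    exact (tsupport_add φ ψ).trans (Set.union_subset hφ' hψ')
  zero_mem' := by
    refine ⟨0, HasCompactSupport.zero, ?_, by rw [map_zero, map_zero]⟩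
    have : tsupport (0 : EuclideanSpace ℝ (Fin n) → ℂ) = ∅ := by simp
    exact this.trans_subset (Set.empty_subset _)
  smul_mem' := by
    rintro c u ⟨φ, hφ, hφ', hu⟩
    refine ⟨c • φ, ?_, ?_, by rw [map_smul, map_smul, hu]⟩
    · exact hφ.mono (Function.support_const_smul_subset c φ)
    · exact (closure_mono (Function.support_const_smul_subset c φ)).trans hφ'

/-- `H^s(Ω)` with a tilde: the closure of `𝓓(Ω)` in `H^s(ℝⁿ)`. -/
def tildeSpace (s : ℝ) (Ω : Set (EuclideanSpace ℝ (Fin n))) : Submodule ℂ (SobolevSpace n s) :=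
  (testFunctions s Ω).topologicalClosure

/-- `H^s(Ω)` with a ring on top: the elements of `H^s(ℝⁿ)` that are (square integrable) functions vanishing almost
everywhere in the complement of `Ω`. To be used for `s ≥ 0` only, when `H^s(ℝⁿ) ⊆ L²(ℝⁿ)`. -/
def circSpace (s : ℝ) (Ω : Set (EuclideanSpace ℝ (Fin n))) : Submodule ℂ (SobolevSpace n s) where
  carrier := {u | ∃ f : Lp ℂ 2 (volume : Measure (EuclideanSpace ℝ (Fin n))),
    toDistribution u = (f : 𝓢'(EuclideanSpace ℝ (Fin n), ℂ)) ∧ ∀ᵐ x, x ∈ Ωᶜ → f x = 0}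
  add_mem' := by
    rintro u v ⟨f, hu, hf⟩ ⟨g, hv, hg⟩
    refine ⟨f + g, ?_, ?_⟩
    · rw [map_add, hu, hv]
      simp only [← Lp.toTemperedDistributionCLM_apply, map_add]
    · filter_upwards [hf, hg, Lp.coeFn_add f g] with x hfx hgx hx hxΩ
      rw [hx, Pi.add_apply, hfx hxΩ, hgx hxΩ, add_zero]
  zero_mem' := by
    refine ⟨0, ?_, ?_⟩
    · simp only [← Lp.toTemperedDistributionCLM_apply, map_zero]
    · filter_upwards [Lp.coeFn_zero ℂ 2 (volume : Measure (EuclideanSpace ℝ (Fin n)))]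
        with x hx _
      rw [hx, Pi.zero_apply]
  smul_mem' := by
    rintro c u ⟨f, hu, hf⟩
    refine ⟨c • f, ?_, ?_⟩
    · rw [map_smul, hu]
      simp only [← Lp.toTemperedDistributionCLM_apply, map_smul]
    · filter_upwards [hf, Lp.coeFn_smul c f] with x hfx hx hxΩ
      rw [hx, Pi.smul_apply, hfx hxΩ, smul_zero]

/-- `H^s_F` for a closed set `F`: the elements of `H^s(ℝⁿ)` whose distributional support lies in
`F`. -/
def supportedIn (s : ℝ) (F : Set (EuclideanSpace ℝ (Fin n))) :
    Submodule ℂ (SobolevSpace n s) where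
  carrier := {u | dsupport (toDistribution u) ⊆ F}
  add_mem' := by
    intro u v hu hv x hx
    by_contra hxF
    obtain ⟨U, hU, hUo, hxU⟩ := (notMem_dsupport_iff x).mp (fun h => hxF (hu h))
    obtain ⟨V, hV, hVo, hxV⟩ := (notMem_dsupport_iff x).mp (fun h => hxF (hv h))
    refine (notMem_dsupport_iff x).mpr ⟨U ∩ V, ?_, hUo.inter hVo, hxU, hxV⟩ hx
    intro φ hφ
    rw [map_add]
    have h1 := hU φ (hφ.trans Set.inter_subset_left)
    have h2 := hV φ (hφ.trans Set.inter_subset_right)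
    change toDistribution u φ + toDistribution v φ = 0
    rw [h1, h2, add_zero]
  zero_mem' := by
    intro x hx
    refine absurd hx ((notMem_dsupport_iff x).mpr ⟨Set.univ, ?_, isOpen_univ, Set.mem_univ x⟩)
    intro φ _
    rw [map_zero]
    rfl
  smul_mem' := by
    intro c u hu x hx
    by_contra hxF
    obtain ⟨U, hU, hUo, hxU⟩ := (notMem_dsupport_iff x).mp (fun h => hxF (hu h))
    refine (notMem_dsupport_iff x).mpr ⟨U, ?_, hUo, hxU⟩ hx
    intro φ hφ
    rw [map_smul]
    change c • toDistribution u φ = 0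
    rw [hU φ hφ, smul_zero]

end SobolevSpace

end

/-!
The set is `Ω = (ball 0 (R + 1) \ E) ∪ (ball c 1 ∩ U)`, where the two balls are disjoint, `E` is a
compact null set inside the first one and `U` is a dense open set of small measure. Each of `E` and
`U` is responsible for one of the strict inclusions, through functionals that are bounded on
`H^s(ℝⁿ)` and vanish on the test functions of `Ω` but not on a certain bump function
(`ofSchwartz_notMem_tildeSpace`). All estimates take place on Schwartz functions, whose `H^s` norm
is the `L²` norm of `(1 + |ξ|²) ^ (s / 2) 𝓕 φ`.

*The set `E`, for `s > 0`.* Take the points of the unit cube whose first coordinate has zeros at the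
binary places `1, 4, 9, …`. It is a null set, so that a bump function supported in the first ball
vanishes almost everywhere outside `Ω` even if it is equal to `1` near `E`. The normalized
restrictions of Lebesgue measure to the finite stages converge to a measure carried by `E`. The
measures number `k` and `k + 1` differ by a translation of half of the mass by
`h = 2 ^ (-(k + 1) ^ 2)`, and `‖φ - φ(· + h)‖ ≤ C h ^ σ ‖φ‖_{H^σ}` in `L²`, for `0 ≤ σ ≤ 1`; as the
densities are of size `2 ^ k` only, the sum of the differences converges for every `σ > 0`
(`exists_isCompact_volume_zero_notMem_tildeSpace`).

*The set `U`, for `s ≥ -n/2`.* Points have capacity zero in `H^(n/2)(ℝⁿ)`: this norm is bounded on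
the dilates `ψ(2 ^ j ·)` of a bump function, these are almost orthogonal, and hence their averages
are equal to `1` near the origin and have small norm
(`exists_eventuallyEq_one_norm_ofSchwartz_lt`). Multiplication by a Schwartz function being bounded
on `H^(n/2)(ℝⁿ)`, a bump function can be cut off near every point of a dense sequence with a total
change as small as desired. The limit is a nonzero element of `H^(n/2)(ℝⁿ)`, the dual of
`H^(-n/2)(ℝⁿ)`, which vanishes on a dense open set `U`
(`exists_dense_isOpen_notMem_tildeSpace`).

The remaining strict inclusion holds because `closure Ω` contains `closedBall c 1`, while `U` does
not have full measure in `closedBall c (1 / 2)`.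
-/

open FourierTransform

namespace SobolevSpace

variable {n : ℕ} {s t : ℝ}

/-! ### Schwartz functions as elements of the Sobolev spaces -/

/-- The Fourier transform of a Schwartz function, multiplied by `(1 + |ξ|²) ^ (s / 2)`: its `L²`
norm is the `H^s` norm of the function. -/
noncomputable def weightedFourier (s : ℝ) :
    𝓢(EuclideanSpace ℝ (Fin n), ℂ) →L[ℂ] 𝓢(EuclideanSpace ℝ (Fin n), ℂ) :=
  (SchwartzMap.smulLeftCLM ℂ (fun x : EuclideanSpace ℝ (Fin n) ↦
    (((1 + ‖x‖ ^ 2) ^ (s / 2) : ℝ) : ℂ))).comp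
    (SchwartzMap.fourierTransformCLM ℂ)

theorem weightedFourier_apply (φ : 𝓢(EuclideanSpace ℝ (Fin n), ℂ))
    (ξ : EuclideanSpace ℝ (Fin n)) :
    weightedFourier s φ ξ = (((1 + ‖ξ‖ ^ 2) ^ (s / 2) : ℝ) : ℂ) * 𝓕 φ ξ := by
  rw [weightedFourier, ContinuousLinearMap.comp_apply,
    SchwartzMap.smulLeftCLM_apply_apply (by fun_prop)]
  rfl

theorem norm_weightedFourier_apply (φ : 𝓢(EuclideanSpace ℝ (Fin n), ℂ))
    (ξ : EuclideanSpace ℝ (Fin n)) :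
    ‖weightedFourier s φ ξ‖ = (1 + ‖ξ‖ ^ 2) ^ (s / 2) * ‖𝓕 φ ξ‖ := by
  rw [weightedFourier_apply, norm_mul, Complex.norm_real, Real.norm_of_nonneg (by positivity)]

/-- A Schwartz function as an element of `H^s(ℝⁿ)`. -/
noncomputable def ofSchwartz (n : ℕ) (s : ℝ) :
    𝓢(EuclideanSpace ℝ (Fin n), ℂ) →ₗ[ℂ] SobolevSpace n s :=
  LinearMap.codRestrict (sobolevSubmodule n s)
    (SchwartzMap.toTemperedDistributionCLM (EuclideanSpace ℝ (Fin n)) ℂ volume).toLinearMap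
    (fun φ => φ.memSobolev)

theorem toDistribution_ofSchwartz (φ : 𝓢(EuclideanSpace ℝ (Fin n), ℂ)) :
    toDistribution (ofSchwartz n s φ) = (φ : 𝓢'(EuclideanSpace ℝ (Fin n), ℂ)) := rfl

theorem norm_ofSchwartz (φ : 𝓢(EuclideanSpace ℝ (Fin n), ℂ)) :
    ‖ofSchwartz n s φ‖ = ‖(weightedFourier s φ).toLp 2‖ := by
  set ψ := SchwartzMap.fourierMultiplierCLM ℂ
    (fun x : EuclideanSpace ℝ (Fin n) ↦ (((1 + ‖x‖ ^ 2) ^ (s / 2) : ℝ) : ℂ)) φ with hψ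
  have h1 : besselLp (ofSchwartz n s φ) = ψ.toLp 2 := by
    apply lp_toTemperedDistribution_injective
    change (besselLp (ofSchwartz n s φ) : 𝓢'(EuclideanSpace ℝ (Fin n), ℂ)) =
      (ψ.toLp 2 : 𝓢'(EuclideanSpace ℝ (Fin n), ℂ))
    rw [← besselPotential_toDistribution, toDistribution_ofSchwartz, besselPotential,
      Lp.toTemperedDistribution_toLp_eq,
      fourierMultiplierCLM_toTemperedDistributionCLM_eq (by fun_prop)]
  have h2 : weightedFourier s φ = 𝓕 ψ := by
    rw [hψ, SchwartzMap.fourierMultiplierCLM_apply, fourier_fourierInv_eq]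
    rfl
  rw [norm_eq, h1, h2, SchwartzMap.norm_fourier_toL2_eq]

theorem norm_toLp_le_of_le {f g : 𝓢(EuclideanSpace ℝ (Fin n), ℂ)} {C : ℝ}
    (h : ∀ x, ‖f x‖ ≤ C * ‖g x‖) : ‖f.toLp 2‖ ≤ C * ‖g.toLp 2‖ := by
  apply Lp.norm_le_mul_norm_of_ae_le_mul
  filter_upwards [f.coeFn_toLp 2, g.coeFn_toLp 2] with x hf hg
  rw [hf, hg]
  exact h x

theorem norm_ofSchwartz_mono (h : s ≤ t) (φ : 𝓢(EuclideanSpace ℝ (Fin n), ℂ)) :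
    ‖ofSchwartz n s φ‖ ≤ ‖ofSchwartz n t φ‖ := by
  rw [norm_ofSchwartz, norm_ofSchwartz, ← one_mul ‖(weightedFourier t φ).toLp 2 volume‖]
  refine norm_toLp_le_of_le fun x => ?_
  rw [norm_weightedFourier_apply, norm_weightedFourier_apply, one_mul]
  gcongr
  simp

theorem norm_toLp_le_norm_ofSchwartz (h : 0 ≤ s) (φ : 𝓢(EuclideanSpace ℝ (Fin n), ℂ)) :
    ‖φ.toLp 2‖ ≤ ‖ofSchwartz n s φ‖ := by
  refine le_trans (le_of_eq ?_) (norm_ofSchwartz_mono h φ)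
  rw [norm_ofSchwartz, ← SchwartzMap.norm_fourier_toL2_eq]
  congr 2
  ext x
  simp [weightedFourier_apply]

/-- The `L²` pairing is bounded on `H^t × H^(-t)`: on the Fourier side the weights cancel. -/
theorem norm_inner_toLp_le (h : -t ≤ s) (φ ψ : 𝓢(EuclideanSpace ℝ (Fin n), ℂ)) :
    ‖inner ℂ (φ.toLp 2) (ψ.toLp 2)‖ ≤ ‖ofSchwartz n t φ‖ * ‖ofSchwartz n s ψ‖ := by
  have key : inner ℂ (φ.toLp 2) (ψ.toLp 2) =
      inner ℂ ((weightedFourier t φ).toLp 2) ((weightedFourier (-t) ψ).toLp 2) := by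
    rw [← SchwartzMap.inner_fourier_toL2_eq, SchwartzMap.inner_toL2_toL2_eq _ _ volume,
      SchwartzMap.inner_toL2_toL2_eq _ _ volume]
    congr 1
    ext ξ
    have : (1 + ‖ξ‖ ^ 2) ^ (t / 2) * (1 + ‖ξ‖ ^ 2) ^ (-t / 2) = 1 := by
      rw [← Real.rpow_add (by positivity)]
      ring_nf
      simp
    simp only [weightedFourier_apply, RCLike.inner_apply, map_mul, Complex.conj_ofReal]
    have h1 : (((1 + ‖ξ‖ ^ 2) ^ (t / 2) : ℝ) : ℂ) * (((1 + ‖ξ‖ ^ 2) ^ (-t / 2) : ℝ) : ℂ) = 1 := by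
      exact_mod_cast this
    linear_combination -(𝓕 ψ ξ * starRingEnd ℂ (𝓕 φ ξ)) * h1
  rw [key]
  refine (norm_inner_le_norm _ _).trans ?_
  rw [← norm_ofSchwartz, ← norm_ofSchwartz]
  gcongr
  exact norm_ofSchwartz_mono h ψ

theorem exists_of_mem_tildeSpace {Ω : Set (EuclideanSpace ℝ (Fin n))} {u : SobolevSpace n s}
    (hu : u ∈ tildeSpace s Ω) {ε : ℝ} (hε : 0 < ε) :
    ∃ φ : 𝓢(EuclideanSpace ℝ (Fin n), ℂ), HasCompactSupport φ ∧ tsupport φ ⊆ Ω ∧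
      ‖u - ofSchwartz n s φ‖ < ε := by
  have hu' : u ∈ closure (testFunctions s Ω : Set (SobolevSpace n s)) := hu
  obtain ⟨v, ⟨φ, hc, hΩ, hv⟩, hd⟩ := Metric.mem_closure_iff.mp hu' ε hε
  refine ⟨φ, hc, hΩ, ?_⟩
  rw [dist_eq_norm] at hd
  have : v = ofSchwartz n s φ := toDistribution_injective hv
  rwa [← this]

/-- Functionals that are uniformly bounded in the `H^s` norm and vanish eventually on each test
function of `Ω` separate the closure of the test functions from the Schwartz functions where they
stay away from zero. -/
theorem ofSchwartz_notMem_tildeSpace {Ω : Set (EuclideanSpace ℝ (Fin n))}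
    (ℓ : ℕ → 𝓢(EuclideanSpace ℝ (Fin n), ℂ) →ₗ[ℂ] ℂ) {C : ℝ}
    (hC : ∀ k φ, ‖ℓ k φ‖ ≤ C * ‖ofSchwartz n s φ‖)
    (hΩ : ∀ φ : 𝓢(EuclideanSpace ℝ (Fin n), ℂ), HasCompactSupport φ → tsupport φ ⊆ Ω →
      ∀ᶠ k in Filter.atTop, ℓ k φ = 0)
    {φ₀ : 𝓢(EuclideanSpace ℝ (Fin n), ℂ)} {δ : ℝ} (hδ : 0 < δ) (h₀ : ∀ k, δ ≤ ‖ℓ k φ₀‖) :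
    ofSchwartz n s φ₀ ∉ tildeSpace s Ω := by
  intro hmem
  have hC0 : 0 < C := by
    by_contra! h
    have := (hC 0 φ₀).trans (mul_nonpos_of_nonpos_of_nonneg h (norm_nonneg _))
    linarith [h₀ 0]
  obtain ⟨φ, hc, hφ, hlt⟩ := exists_of_mem_tildeSpace hmem (div_pos hδ hC0)
  obtain ⟨k, hk⟩ := (hΩ φ hc hφ).exists
  have h1 := hC k (φ₀ - φ)
  rw [map_sub, map_sub, hk, sub_zero] at h1
  rw [lt_div_iff₀ hC0] at hlt
  linarith [h₀ k]

/-! ### The inclusions between the three spaces -/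

theorem continuous_toDistribution_apply (φ : 𝓢(EuclideanSpace ℝ (Fin n), ℂ)) :
    Continuous fun u : SobolevSpace n s => toDistribution u φ := by
  have hb : Continuous (besselLp : SobolevSpace n s →ₗ[ℂ] _) := by
    refine AddMonoidHomClass.continuous_of_bound besselLp 1 fun u => ?_
    rw [one_mul, norm_eq]
  -- `u` is recovered from its Bessel potential, an `L²` function that depends continuously on `u`
  have h : (fun u : SobolevSpace n s => toDistribution u φ) = fun u =>
      besselPotential (EuclideanSpace ℝ (Fin n)) ℂ (-s)
        (Lp.toTemperedDistributionCLM ℂ volume 2 (besselLp u)) φ := by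
    ext u
    rw [Lp.toTemperedDistributionCLM_apply, ← besselPotential_toDistribution]
    simp
  rw [h]
  have h2 := ((besselPotential (EuclideanSpace ℝ (Fin n)) ℂ (-s)).continuous.comp
    (Lp.toTemperedDistributionCLM ℂ volume 2).continuous).comp hb
  exact (continuous_eval_const φ).comp h2

theorem tildeSpace_le_supportedIn (s : ℝ) (Ω : Set (EuclideanSpace ℝ (Fin n))) :
    tildeSpace s Ω ≤ supportedIn s (closure Ω) := by
  intro u hu x hx
  by_contra hxΩ
  refine (notMem_dsupport_iff x).mpr
    ⟨(closure Ω)ᶜ, fun φ hφ => ?_, isClosed_closure.isOpen_compl, hxΩ⟩ hx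
  have hcl : IsClosed {v : SobolevSpace n s | toDistribution v φ = 0} :=
    isClosed_eq (continuous_toDistribution_apply φ) continuous_const
  refine closure_minimal ?_ hcl hu
  rintro v ⟨ψ, -, hψ, hv⟩
  change toDistribution v φ = 0
  rw [hv, SchwartzMap.coe_apply]
  refine integral_eq_zero_of_ae (ae_of_all _ fun y => ?_)
  by_cases hy : y ∈ closure Ω
  · have : φ y = 0 := image_eq_zero_of_notMem_tsupport fun h => hφ h hy
    simp [this]
  · have : ψ y = 0 := image_eq_zero_of_notMem_tsupport fun h => hy (subset_closure (hψ h))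
    simp [this]

theorem circSpace_le_supportedIn (s : ℝ) (Ω : Set (EuclideanSpace ℝ (Fin n))) :
    circSpace s Ω ≤ supportedIn s (closure Ω) := by
  rintro u ⟨f, hu, hf⟩ x hx
  by_contra hxΩ
  refine (notMem_dsupport_iff x).mpr
    ⟨(closure Ω)ᶜ, fun φ hφ => ?_, isClosed_closure.isOpen_compl, hxΩ⟩ hx
  rw [hu, Lp.toTemperedDistribution_apply]
  refine integral_eq_zero_of_ae ?_
  filter_upwards [hf] with y hy
  by_cases hyΩ : y ∈ Ω
  · have : φ y = 0 := image_eq_zero_of_notMem_tsupport fun h => hφ h (subset_closure hyΩ)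
    simp [this]
  · simp [hy hyΩ]

theorem ofSchwartz_mem_supportedIn {F : Set (EuclideanSpace ℝ (Fin n))}
    (hF : IsClosed F) {φ : 𝓢(EuclideanSpace ℝ (Fin n), ℂ)} (hφ : tsupport φ ⊆ F) :
    ofSchwartz n s φ ∈ supportedIn s F := by
  intro x hx
  by_contra hxF
  refine (notMem_dsupport_iff x).mpr ⟨Fᶜ, fun ψ hψ => ?_, hF.isOpen_compl, hxF⟩ hx
  rw [toDistribution_ofSchwartz, SchwartzMap.coe_apply]
  refine integral_eq_zero_of_ae (ae_of_all _ fun y => ?_)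
  by_cases hy : y ∈ F
  · have : ψ y = 0 := image_eq_zero_of_notMem_tsupport fun h => hψ h hy
    simp [this]
  · have : φ y = 0 := image_eq_zero_of_notMem_tsupport fun h => hy (hφ h)
    simp [this]

theorem ofSchwartz_mem_circSpace_iff {Ω : Set (EuclideanSpace ℝ (Fin n))}
    {φ : 𝓢(EuclideanSpace ℝ (Fin n), ℂ)} :
    ofSchwartz n s φ ∈ circSpace s Ω ↔ ∀ᵐ x, x ∈ Ωᶜ → φ x = 0 := by
  constructor
  · rintro ⟨f, hf, h⟩
    have : φ.toLp 2 = f := by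
      apply lp_toTemperedDistribution_injective
      change (φ.toLp 2 : 𝓢'(EuclideanSpace ℝ (Fin n), ℂ)) =
        (f : 𝓢'(EuclideanSpace ℝ (Fin n), ℂ))
      rw [← hf, Lp.toTemperedDistribution_toLp_eq, toDistribution_ofSchwartz]
    subst this
    filter_upwards [h, φ.coeFn_toLp 2] with x hx hx'
    rwa [hx'] at hx
  · intro h
    refine ⟨φ.toLp 2, ?_, ?_⟩
    · rw [Lp.toTemperedDistribution_toLp_eq, toDistribution_ofSchwartz]
    · filter_upwards [h, φ.coeFn_toLp 2] with x hx hx'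
      rwa [hx']

/-- The `L²` functions vanishing almost everywhere on a set form a closed subspace, and the `H^s`
norm dominates the `L²` norm. -/
theorem tildeSpace_le_circSpace (hs : 0 ≤ s) (Ω : Set (EuclideanSpace ℝ (Fin n))) :
    tildeSpace s Ω ≤ circSpace s Ω := by
  intro u hu
  have hpos : ∀ k : ℕ, (0 : ℝ) < 1 / (k + 1) := fun k => by positivity
  choose φ hc hΩ hlt using fun k : ℕ => exists_of_mem_tildeSpace hu (hpos k)
  have hconv : Filter.Tendsto (fun k => ofSchwartz n s (φ k)) Filter.atTop (nhds u) := by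
    rw [tendsto_iff_norm_sub_tendsto_zero]
    refine squeeze_zero (fun _ => norm_nonneg _) (fun k => ?_)
      tendsto_one_div_add_atTop_nhds_zero_nat
    rw [norm_sub_rev]
    exact (hlt k).le
  have hcauchy : CauchySeq fun k => (φ k).toLp 2 := by
    have h := hconv.cauchySeq
    rw [Metric.cauchySeq_iff] at h ⊢
    intro ε hε
    obtain ⟨N, hN⟩ := h ε hε
    refine ⟨N, fun k hk m hm => lt_of_le_of_lt ?_ (hN k hk m hm)⟩
    rw [dist_eq_norm, dist_eq_norm, ← map_sub]
    exact norm_toLp_le_norm_ofSchwartz hs (φ k - φ m)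
  obtain ⟨f, hf⟩ := cauchySeq_tendsto_of_complete hcauchy
  refine ⟨f, ?_, ?_⟩
  · ext ψ
    refine tendsto_nhds_unique ((continuous_toDistribution_apply ψ).tendsto u |>.comp hconv) ?_
    have h2 : Continuous fun g : Lp ℂ 2 (volume : Measure (EuclideanSpace ℝ (Fin n))) =>
        Lp.toTemperedDistributionCLM ℂ volume 2 g ψ :=
      (continuous_eval_const ψ).comp (Lp.toTemperedDistributionCLM ℂ volume 2).continuous
    refine (h2.tendsto f |>.comp hf).congr fun k => ?_
    simp only [Function.comp_apply]
    rw [Lp.toTemperedDistributionCLM_apply, Lp.toTemperedDistribution_toLp_eq,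
      toDistribution_ofSchwartz]
  · -- a subsequence converges almost everywhere
    obtain ⟨ns, -, hns⟩ := (tendstoInMeasure_of_tendsto_Lp hf).exists_seq_tendsto_ae
    have hall : ∀ᵐ x, ∀ k, (φ k).toLp 2 volume x = φ k x :=
      ae_all_iff.mpr fun k => (φ k).coeFn_toLp 2 volume
    filter_upwards [hns, hall] with x hx hx' hxΩ
    refine tendsto_nhds_unique hx (tendsto_const_nhds.congr fun k => ?_)
    rw [hx']
    exact (image_eq_zero_of_notMem_tsupport fun h => hxΩ (hΩ _ h)).symm

/-! ### Translations -/

theorem fourier_compSubConstCLM_apply (φ : 𝓢(EuclideanSpace ℝ (Fin n), ℂ))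
    (a ξ : EuclideanSpace ℝ (Fin n)) :
    𝓕 (SchwartzMap.compSubConstCLM ℂ a φ) ξ = Real.fourierChar (-inner ℝ a ξ) • 𝓕 φ ξ := by
  have h := congrFun (VectorFourier.fourierIntegral_comp_add_right Real.fourierChar
    (volume : Measure (EuclideanSpace ℝ (Fin n))) (innerₗ (EuclideanSpace ℝ (Fin n))) φ (-a)) ξ
  rw [SchwartzMap.fourier_coe, SchwartzMap.fourier_coe]
  have h2 : (innerₗ (EuclideanSpace ℝ (Fin n))) (-a) ξ = -inner ℝ a ξ := by simp
  rw [h2] at h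
  refine Eq.trans ?_ h
  congr 1

/-- The elementary bound behind the fractional smoothness estimate for translations. -/
theorem norm_one_sub_fourierChar_le {σ : ℝ} (hσ : 0 ≤ σ) (hσ1 : σ ≤ 1) (x : ℝ) :
    ‖(1 : ℂ) - Real.fourierChar x‖ ≤ 2 * (2 * Real.pi * |x|) ^ σ := by
  have h2 : ‖(1 : ℂ) - Real.fourierChar x‖ ≤ 2 := by
    refine (norm_sub_le _ _).trans ?_
    rw [norm_one, Circle.norm_coe]
    norm_num
  have h1 : ‖(1 : ℂ) - Real.fourierChar x‖ ≤ 2 * Real.pi * |x| := by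
    rw [norm_sub_rev, Real.fourierChar_apply, mul_comm _ Complex.I]
    refine (Real.norm_exp_I_mul_ofReal_sub_one_le).trans ?_
    rw [Real.norm_eq_abs, abs_mul, abs_of_pos Real.two_pi_pos]
  have h0 : 0 ≤ 2 * Real.pi * |x| := by positivity
  rcases le_total (2 * Real.pi * |x|) 1 with h | h
  · have := Real.rpow_le_rpow_of_exponent_ge' h0 h hσ hσ1
    rw [Real.rpow_one] at this
    linarith
  · have := Real.one_le_rpow h hσ
    linarith

/-- Translations are Hölder continuous of order `σ` in `L²` on functions of `H^σ`. -/
theorem norm_toLp_sub_compSubConst_le {σ : ℝ} (hσ : 0 ≤ σ) (hσ1 : σ ≤ 1)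
    (φ : 𝓢(EuclideanSpace ℝ (Fin n), ℂ)) (a : EuclideanSpace ℝ (Fin n)) :
    ‖(φ - SchwartzMap.compSubConstCLM ℂ a φ).toLp 2‖ ≤
      2 * (2 * Real.pi * ‖a‖) ^ σ * ‖ofSchwartz n σ φ‖ := by
  rw [← SchwartzMap.norm_fourier_toL2_eq, norm_ofSchwartz]
  refine norm_toLp_le_of_le fun ξ => ?_
  rw [norm_weightedFourier_apply, ← mul_assoc]
  have h : 𝓕 (φ - SchwartzMap.compSubConstCLM ℂ a φ) ξ =
      ((1 : ℂ) - Real.fourierChar (-inner ℝ a ξ)) * 𝓕 φ ξ := by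
    have : 𝓕 (φ - SchwartzMap.compSubConstCLM ℂ a φ) =
      𝓕 φ - 𝓕 (SchwartzMap.compSubConstCLM ℂ a φ) :=
      map_sub (SchwartzMap.fourierTransformCLM ℂ) _ _
    rw [this, sub_apply, fourier_compSubConstCLM_apply, Circle.smul_def, smul_eq_mul]
    ring
  rw [h, norm_mul]
  gcongr
  refine (norm_one_sub_fourierChar_le hσ hσ1 _).trans ?_
  rw [mul_assoc (2 : ℝ) ((2 * Real.pi * ‖a‖) ^ σ)]
  refine mul_le_mul_of_nonneg_left ?_ zero_le_two
  have h1 : 2 * Real.pi * |-inner ℝ a ξ| ≤ 2 * Real.pi * ‖a‖ * ‖ξ‖ := by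
    rw [abs_neg, mul_assoc (2 * Real.pi)]
    exact mul_le_mul_of_nonneg_left (abs_real_inner_le_norm a ξ) (by positivity)
  refine (Real.rpow_le_rpow (by positivity) h1 hσ).trans ?_
  rw [Real.mul_rpow (by positivity) (norm_nonneg _)]
  gcongr
  have h2 : ‖ξ‖ ^ σ = (‖ξ‖ ^ 2) ^ (σ / 2) := by
    rw [← Real.rpow_natCast, ← Real.rpow_mul (norm_nonneg _)]
    congr 1
    push_cast
    ring
  rw [h2]
  gcongr
  simp

/-! ### Multiplication by a Schwartz function -/

/-- Young's inequality for the convolution of an `L¹` function with an `L²` function. -/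
theorem lintegral_sq_lintegral_mul_le {E : Type*} [MeasurableSpace E] [AddCommGroup E]
    [MeasurableAdd₂ E] {μ : Measure E} [SFinite μ] [μ.IsAddLeftInvariant] {A g : E → ENNReal}
    (hA : Measurable A) (hg : Measurable g) :
    ∫⁻ ξ, (∫⁻ y, A y * g (ξ + y) ∂μ) ^ 2 ∂μ ≤ (∫⁻ y, A y ∂μ) ^ 2 * ∫⁻ ξ, g ξ ^ 2 ∂μ := by
  have hpt : ∀ ξ, (∫⁻ y, A y * g (ξ + y) ∂μ) ^ 2 ≤
      (∫⁻ y, A y ∂μ) * ∫⁻ y, A y * g (ξ + y) ^ 2 ∂μ := by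
    intro ξ
    -- Cauchy-Schwarz for the factors `A ^ (1 / 2)` and `A ^ (1 / 2) g`
    have hAhalf : ∀ y, A y ^ (1 / 2 : ℝ) * A y ^ (1 / 2 : ℝ) = A y := fun y => by
      rw [← ENNReal.rpow_add_of_nonneg _ _ (by norm_num) (by norm_num)]
      norm_num
    have h := ENNReal.lintegral_mul_le_Lp_mul_Lq μ Real.HolderConjugate.two_two
      (f := fun y => A y ^ (1 / 2 : ℝ)) (g := fun y => A y ^ (1 / 2 : ℝ) * g (ξ + y))
      (by fun_prop) (by fun_prop)
    have h1 : ∀ y, (A y ^ (1 / 2 : ℝ)) ^ (2 : ℝ) = A y := fun y => by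
      rw [← ENNReal.rpow_mul]; norm_num
    have h2 : ∀ y, (A y ^ (1 / 2 : ℝ) * g (ξ + y)) ^ (2 : ℝ) = A y * g (ξ + y) ^ 2 := fun y => by
      rw [ENNReal.mul_rpow_of_nonneg _ _ (by norm_num), h1, ENNReal.rpow_two]
    simp only [Pi.mul_apply, h1, h2, ← mul_assoc, hAhalf] at h
    calc _ ≤ ((∫⁻ y, A y ∂μ) ^ (1 / 2 : ℝ) *
          (∫⁻ y, A y * g (ξ + y) ^ 2 ∂μ) ^ (1 / 2 : ℝ)) ^ 2 := by gcongr
      _ = _ := by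
        rw [mul_pow, ← ENNReal.rpow_two, ← ENNReal.rpow_two, ← ENNReal.rpow_mul,
          ← ENNReal.rpow_mul]
        norm_num
  calc _ ≤ ∫⁻ ξ, (∫⁻ y, A y ∂μ) * ∫⁻ y, A y * g (ξ + y) ^ 2 ∂μ ∂μ := lintegral_mono hpt
    _ = (∫⁻ y, A y ∂μ) * ∫⁻ ξ, ∫⁻ y, A y * g (ξ + y) ^ 2 ∂μ ∂μ := by
      rw [lintegral_const_mul]
      exact Measurable.lintegral_prod_right' (f := fun p : E × E => A p.2 * g (p.1 + p.2) ^ 2)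
        (by fun_prop)
    _ = (∫⁻ y, A y ∂μ) * ∫⁻ y, ∫⁻ ξ, A y * g (ξ + y) ^ 2 ∂μ ∂μ := by
      rw [lintegral_lintegral_swap]
      exact Measurable.aemeasurable (by fun_prop)
    _ = (∫⁻ y, A y ∂μ) * ∫⁻ y, A y * ∫⁻ ξ, g ξ ^ 2 ∂μ ∂μ := by
      congr 2
      ext y
      rw [lintegral_const_mul _ (by fun_prop)]
      congr 1
      have := lintegral_add_left_eq_self (μ := μ) (fun ξ => g ξ ^ 2) y
      simpa [add_comm] using this
    _ = _ := by
      rw [lintegral_mul_const _ hA, sq, mul_assoc]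

theorem enorm_toLp_sq (f : 𝓢(EuclideanSpace ℝ (Fin n), ℂ)) :
    ENNReal.ofReal ‖f.toLp 2‖ ^ 2 = ∫⁻ x, ‖f x‖ₑ ^ 2 := by
  rw [SchwartzMap.norm_toLp, ENNReal.ofReal_toReal (f.eLpNorm_lt_top 2 volume).ne,
    eLpNorm_eq_lintegral_rpow_enorm_toReal (by norm_num) (by norm_num), ← ENNReal.rpow_two,
    ← ENNReal.rpow_mul]
  norm_num

/-- Peetre's inequality, in the multiplicative form needed for convolutions. -/
theorem one_add_norm_sq_rpow_le {E : Type*} [NormedAddCommGroup E] (ht : 0 ≤ t) (ξ y : E) :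
    (1 + ‖ξ‖ ^ 2) ^ (t / 2) ≤
      2 ^ (t / 2) * (1 + ‖y‖ ^ 2) ^ (t / 2) * (1 + ‖ξ + y‖ ^ 2) ^ (t / 2) := by
  rw [← Real.mul_rpow (by positivity) (by positivity),
    ← Real.mul_rpow (by positivity) (by positivity)]
  refine Real.rpow_le_rpow (by positivity) ?_ (by positivity)
  have h : ‖ξ‖ ≤ ‖ξ + y‖ + ‖y‖ := by simpa using norm_sub_le (ξ + y) y
  have h2 : ‖ξ‖ ^ 2 ≤ (‖ξ + y‖ + ‖y‖) ^ 2 := by gcongr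
  nlinarith [sq_nonneg (‖ξ + y‖ - ‖y‖), mul_nonneg (sq_nonneg ‖ξ + y‖) (sq_nonneg ‖y‖)]

open Convolution in
/-- The Fourier transform of a product is a convolution; the inverse transform of one factor
replaces a reflection. -/
theorem fourier_mul_apply (χ φ : 𝓢(EuclideanSpace ℝ (Fin n), ℂ))
    (ξ : EuclideanSpace ℝ (Fin n)) :
    𝓕 (SchwartzMap.pairing (ContinuousLinearMap.mul ℂ ℂ) χ φ) ξ =
      ∫ y, 𝓕⁻ χ y * 𝓕 φ (ξ + y) := by
  have h : SchwartzMap.pairing (ContinuousLinearMap.mul ℂ ℂ) χ φ =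
      𝓕 (SchwartzMap.convolution (ContinuousLinearMap.mul ℂ ℂ) (𝓕⁻ χ) (𝓕⁻ φ)) := by
    rw [SchwartzMap.fourier_convolution, fourier_fourierInv_eq, fourier_fourierInv_eq]
  have hneg : ∀ (f : 𝓢(EuclideanSpace ℝ (Fin n), ℂ)) (x : EuclideanSpace ℝ (Fin n)),
      𝓕 f x = 𝓕⁻ f (-x) := fun f x => by
    rw [SchwartzMap.fourierInv_coe, Real.fourierInv_eq_fourier_neg, neg_neg,
      SchwartzMap.fourier_coe]
  rw [hneg, h, fourierInv_fourier_eq, SchwartzMap.convolution_apply, convolution_def]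
  congr 1
  ext y
  rw [hneg φ, ContinuousLinearMap.mul_apply']
  congr 2
  abel

/-- Multiplication by a fixed Schwartz function is bounded on `H^t`. -/
theorem exists_norm_ofSchwartz_mul_le (ht : 0 ≤ t) (χ : 𝓢(EuclideanSpace ℝ (Fin n), ℂ)) :
    ∃ C : ℝ, 0 ≤ C ∧ ∀ φ : 𝓢(EuclideanSpace ℝ (Fin n), ℂ),
      ‖ofSchwartz n t (SchwartzMap.pairing (ContinuousLinearMap.mul ℂ ℂ) χ φ)‖ ≤
        C * ‖ofSchwartz n t φ‖ := by
  -- the Schwartz function `(1 + |y|²) ^ (t / 2) 𝓕⁻ χ`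
  set a := SchwartzMap.smulLeftCLM ℂ (fun x : EuclideanSpace ℝ (Fin n) ↦
    (((1 + ‖x‖ ^ 2) ^ (t / 2) : ℝ) : ℂ)) (𝓕⁻ χ) with ha
  have hanorm : ∀ y, ‖a y‖ = (1 + ‖y‖ ^ 2) ^ (t / 2) * ‖𝓕⁻ χ y‖ := fun y => by
    rw [ha, SchwartzMap.smulLeftCLM_apply_apply (by fun_prop), smul_eq_mul, norm_mul,
      Complex.norm_real, Real.norm_of_nonneg (by positivity)]
  refine ⟨2 ^ (t / 2) * ∫ y, ‖a y‖, by positivity, fun φ => ?_⟩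
  set g := weightedFourier t φ
  set K : ENNReal := ENNReal.ofReal (2 ^ (t / 2))
  have hpt : ∀ ξ, ‖weightedFourier t (SchwartzMap.pairing (ContinuousLinearMap.mul ℂ ℂ) χ φ) ξ‖ₑ ≤
      ∫⁻ y, (K * ‖a y‖ₑ) * ‖g (ξ + y)‖ₑ := by
    intro ξ
    rw [← ofReal_norm, norm_weightedFourier_apply, fourier_mul_apply,
      ENNReal.ofReal_mul (by positivity), ofReal_norm]
    calc _ ≤ ENNReal.ofReal ((1 + ‖ξ‖ ^ 2) ^ (t / 2)) * ∫⁻ y, ‖𝓕⁻ χ y * 𝓕 φ (ξ + y)‖ₑ := by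
          gcongr
          exact enorm_integral_le_lintegral_enorm _
      _ = ∫⁻ y, ENNReal.ofReal ((1 + ‖ξ‖ ^ 2) ^ (t / 2)) * ‖𝓕⁻ χ y * 𝓕 φ (ξ + y)‖ₑ := by
          rw [lintegral_const_mul']
          exact ENNReal.ofReal_ne_top
      _ ≤ _ := by
          refine lintegral_mono fun y => ?_
          rw [← ofReal_norm, ← ofReal_norm, ← ofReal_norm, ← ENNReal.ofReal_mul (by positivity),
            ← ENNReal.ofReal_mul (by positivity), ← ENNReal.ofReal_mul (by positivity)]
          refine ENNReal.ofReal_le_ofReal ?_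
          rw [hanorm, norm_weightedFourier_apply, norm_mul]
          calc _ ≤ (2 ^ (t / 2) * (1 + ‖y‖ ^ 2) ^ (t / 2) * (1 + ‖ξ + y‖ ^ 2) ^ (t / 2)) *
                (‖𝓕⁻ χ y‖ * ‖𝓕 φ (ξ + y)‖) := by
                gcongr
                exact one_add_norm_sq_rpow_le ht ξ y
            _ = _ := by ring
  have hK : ENNReal.ofReal (2 ^ (t / 2) * ∫ y, ‖a y‖) = ∫⁻ y, K * ‖a y‖ₑ := by
    rw [ENNReal.ofReal_mul (by positivity), lintegral_const_mul' _ _ ENNReal.ofReal_ne_top,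
      ofReal_integral_norm_eq_lintegral_enorm a.integrable]
  have hfin : ENNReal.ofReal ‖ofSchwartz n t
        (SchwartzMap.pairing (ContinuousLinearMap.mul ℂ ℂ) χ φ)‖ ^ 2 ≤
      ENNReal.ofReal ((2 ^ (t / 2) * ∫ y, ‖a y‖) * ‖ofSchwartz n t φ‖) ^ 2 := by
    rw [ENNReal.ofReal_mul (by positivity), mul_pow, norm_ofSchwartz, norm_ofSchwartz,
      enorm_toLp_sq, enorm_toLp_sq, hK]
    refine le_trans (lintegral_mono fun ξ => ?_) (lintegral_sq_lintegral_mul_le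
      (A := fun y => K * ‖a y‖ₑ) (g := fun ξ => ‖g ξ‖ₑ) ?_ ?_)
    · gcongr
      exact hpt ξ
    · exact (a.continuous.measurable.enorm).const_mul _
    · exact g.continuous.measurable.enorm
  have := (ENNReal.pow_le_pow_left_iff (n := 2) two_ne_zero).mp hfin
  rwa [ENNReal.ofReal_le_ofReal_iff (by positivity)] at this

/-! ### Cutoff functions of small norm in the critical space -/

/-- A smooth bump function as a complex valued Schwartz function. -/
noncomputable def schwartzBump {c : EuclideanSpace ℝ (Fin n)} (b : ContDiffBump c) :
    𝓢(EuclideanSpace ℝ (Fin n), ℂ) :=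
  HasCompactSupport.toSchwartzMap (f := fun x => (b x : ℂ))
    (b.hasCompactSupport.comp_left Complex.ofReal_zero)
    (Complex.ofRealCLM.contDiff.comp b.contDiff)

theorem schwartzBump_apply {c : EuclideanSpace ℝ (Fin n)} (b : ContDiffBump c)
    (x : EuclideanSpace ℝ (Fin n)) : schwartzBump b x = (b x : ℂ) := rfl

/-- The function `x ↦ ψ (2 ^ j • (x - q))`. -/
noncomputable def dyadicDilation (q : EuclideanSpace ℝ (Fin n)) (j : ℕ)
    (ψ : 𝓢(EuclideanSpace ℝ (Fin n), ℂ)) : 𝓢(EuclideanSpace ℝ (Fin n), ℂ) :=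
  SchwartzMap.compSubConstCLM ℂ q (SchwartzMap.compCLMOfContinuousLinearEquiv ℂ
    (ContinuousLinearEquiv.smulLeft (Units.mk0 ((2 : ℝ) ^ j) (by positivity))) ψ)

theorem dyadicDilation_apply (q : EuclideanSpace ℝ (Fin n)) (j : ℕ)
    (ψ : 𝓢(EuclideanSpace ℝ (Fin n), ℂ)) (x : EuclideanSpace ℝ (Fin n)) :
    dyadicDilation q j ψ x = ψ ((2 : ℝ) ^ j • (x - q)) := by
  rw [dyadicDilation, SchwartzMap.compSubConstCLM_apply,
    SchwartzMap.compCLMOfContinuousLinearEquiv_apply]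
  rfl

theorem norm_fourier_dyadicDilation (q : EuclideanSpace ℝ (Fin n)) (j : ℕ)
    (ψ : 𝓢(EuclideanSpace ℝ (Fin n), ℂ)) (ξ : EuclideanSpace ℝ (Fin n)) :
    ‖𝓕 (dyadicDilation q j ψ) ξ‖ = (((2 : ℝ) ^ j) ^ n)⁻¹ * ‖𝓕 ψ (((2 : ℝ) ^ j)⁻¹ • ξ)‖ := by
  rw [dyadicDilation, fourier_compSubConstCLM_apply, Circle.norm_smul, SchwartzMap.fourier_coe,
    SchwartzMap.fourier_coe, Real.fourier_eq, Real.fourier_eq]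
  have h := Measure.integral_comp_smul (volume : Measure (EuclideanSpace ℝ (Fin n)))
    (fun v => Real.fourierChar (-inner ℝ v (((2 : ℝ) ^ j)⁻¹ • ξ)) • ψ v) ((2 : ℝ) ^ j)
  rw [finrank_euclideanSpace_fin, abs_of_nonneg (by positivity)] at h
  have h2 := congrArg norm h
  rw [norm_smul, Real.norm_of_nonneg (by positivity)] at h2
  rw [← h2]
  congr 2
  ext v
  rw [inner_smul_left, inner_smul_right, SchwartzMap.compCLMOfContinuousLinearEquiv_apply]
  simp only [conj_trivial]
  rw [mul_inv_cancel_left₀ (by positivity)]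
  rfl

/-- The dilates of a function are almost orthogonal in the scale invariant Sobolev space
`H^(n/2)(ℝⁿ)`. -/
theorem exists_norm_inner_dyadicDilation_le (hn : 1 ≤ n) (q : EuclideanSpace ℝ (Fin n))
    (ψ : 𝓢(EuclideanSpace ℝ (Fin n), ℂ)) :
    ∃ C : ℝ, 0 ≤ C ∧ ∀ i j, i ≤ j →
      ‖inner ℂ ((weightedFourier (n / 2 : ℝ) (dyadicDilation q i ψ)).toLp 2)
        ((weightedFourier (n / 2 : ℝ) (dyadicDilation q j ψ)).toLp 2)‖ ≤
          C * (1 / 2) ^ (j - i) := by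
  obtain ⟨M, hM, hMb⟩ : ∃ M : ℝ, 0 ≤ M ∧ ∀ ξ, ‖𝓕 ψ ξ‖ ≤ M := by
    obtain ⟨M, hM, h⟩ := (𝓕 ψ).decay 0 0
    exact ⟨M, hM.le, fun ξ => by simpa using h ξ⟩
  set g := weightedFourier (n : ℝ) ψ
  -- the transform of the dilate `j` is bounded by `M 2 ^ (-j n)`, the other factors are integrated
  refine ⟨M * ∫ ξ, ‖g ξ‖, by positivity, fun i j hij => ?_⟩
  rw [SchwartzMap.inner_toL2_toL2_eq _ _ volume]
  have hpt : ∀ ξ, ‖inner ℂ (weightedFourier (n / 2 : ℝ) (dyadicDilation q i ψ) ξ)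
      (weightedFourier (n / 2 : ℝ) (dyadicDilation q j ψ) ξ)‖ ≤
      (((2 : ℝ) ^ j) ^ n)⁻¹ * M * ‖g (((2 : ℝ) ^ i)⁻¹ • ξ)‖ := by
    intro ξ
    refine (norm_inner_le_norm _ _).trans ?_
    rw [norm_weightedFourier_apply, norm_weightedFourier_apply, norm_weightedFourier_apply,
      norm_fourier_dyadicDilation, norm_fourier_dyadicDilation]
    have h1 : (1 + ‖ξ‖ ^ 2) ^ ((n / 2 : ℝ) / 2) * (1 + ‖ξ‖ ^ 2) ^ ((n / 2 : ℝ) / 2) =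
        (1 + ‖ξ‖ ^ 2) ^ ((n : ℝ) / 2) := by
      rw [← Real.rpow_add (by positivity)]
      ring_nf
    have h2 : (1 + ‖ξ‖ ^ 2) ^ ((n : ℝ) / 2) ≤
        ((2 : ℝ) ^ i) ^ n * (1 + ‖((2 : ℝ) ^ i)⁻¹ • ξ‖ ^ 2) ^ ((n : ℝ) / 2) := by
      have h3 : ((2 : ℝ) ^ i) ^ n = (((2 : ℝ) ^ i) ^ 2) ^ ((n : ℝ) / 2) := by
        rw [← Real.rpow_natCast (((2 : ℝ) ^ i)) 2, ← Real.rpow_mul (by positivity),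
          ← Real.rpow_natCast]
        congr 1
        push_cast
        ring
      rw [h3, ← Real.mul_rpow (by positivity) (by positivity)]
      refine Real.rpow_le_rpow (by positivity) ?_ (by positivity)
      rw [norm_smul, mul_pow, norm_inv, Real.norm_of_nonneg (by positivity : (0 : ℝ) ≤ 2 ^ i),
        mul_add, inv_pow, mul_inv_cancel_left₀ (by positivity), mul_one]
      gcongr
      exact one_le_pow₀ (one_le_pow₀ (by norm_num))
    calc _ = (((2 : ℝ) ^ i) ^ n)⁻¹ * (1 + ‖ξ‖ ^ 2) ^ ((n : ℝ) / 2) *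
          ‖𝓕 ψ (((2 : ℝ) ^ i)⁻¹ • ξ)‖ * ((((2 : ℝ) ^ j) ^ n)⁻¹ * ‖𝓕 ψ (((2 : ℝ) ^ j)⁻¹ • ξ)‖) := by
          rw [← h1]; ring
      _ ≤ (((2 : ℝ) ^ i) ^ n)⁻¹ * (((2 : ℝ) ^ i) ^ n *
          (1 + ‖((2 : ℝ) ^ i)⁻¹ • ξ‖ ^ 2) ^ ((n : ℝ) / 2)) *
          ‖𝓕 ψ (((2 : ℝ) ^ i)⁻¹ • ξ)‖ * ((((2 : ℝ) ^ j) ^ n)⁻¹ * M) := by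
          gcongr
          exact hMb _
      _ = _ := by
          rw [inv_mul_cancel_left₀ (by positivity)]
          ring
  have hint : Integrable fun ξ => (((2 : ℝ) ^ j) ^ n)⁻¹ * M * ‖g (((2 : ℝ) ^ i)⁻¹ • ξ)‖ := by
    refine Integrable.const_mul (Integrable.norm ?_) _
    exact (integrable_comp_smul_iff volume g (by positivity)).mpr g.integrable
  calc _ ≤ ∫ ξ, (((2 : ℝ) ^ j) ^ n)⁻¹ * M * ‖g (((2 : ℝ) ^ i)⁻¹ • ξ)‖ :=
        norm_integral_le_of_norm_le hint (ae_of_all _ hpt)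
    _ = (M * ∫ ξ, ‖g ξ‖) * ((((2 : ℝ) ^ j) ^ n)⁻¹ * ((2 : ℝ) ^ i) ^ n) := by
        rw [integral_const_mul, Measure.integral_comp_inv_smul_of_nonneg volume (fun ξ => ‖g ξ‖)
          (by positivity), finrank_euclideanSpace_fin, smul_eq_mul]
        ring
    _ ≤ _ := by
        gcongr
        obtain ⟨k, rfl⟩ := Nat.exists_eq_add_of_le hij
        rw [pow_add, mul_pow, mul_inv, Nat.add_sub_cancel_left, mul_right_comm,
          inv_mul_cancel₀ (by positivity), one_mul, one_div, inv_pow]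
        gcongr
        exact le_self_pow₀ (one_le_pow₀ (by norm_num)) (by omega)

/-- Sums of almost orthogonal vectors grow like the square root of the number of terms. -/
theorem norm_sum_sq_le_of_norm_inner_le {H : Type*} [NormedAddCommGroup H]
    [InnerProductSpace ℂ H] {x : ℕ → H} {C : ℝ} (hC : 0 ≤ C)
    (h : ∀ i j, i ≤ j → ‖inner ℂ (x i) (x j)‖ ≤ C * (1 / 2) ^ (j - i)) (N : ℕ) :
    ‖∑ i ∈ Finset.range N, x i‖ ^ 2 ≤ 3 * C * N := by
  induction N with
  | zero => simp
  | succ N ih =>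
    have h1 : ‖x N‖ ^ 2 ≤ C := by
      have := h N N le_rfl
      rw [inner_self_eq_norm_sq_to_K] at this
      simpa using this
    have h2 : ‖inner ℂ (∑ i ∈ Finset.range N, x i) (x N)‖ ≤ C := by
      rw [sum_inner]
      refine (norm_sum_le_of_le _ fun i hi => h i N (Finset.mem_range.mp hi).le).trans ?_
      rw [← Finset.mul_sum]
      refine mul_le_of_le_one_right hC ?_
      have : ∀ N : ℕ, ∑ i ∈ Finset.range N, (1 / 2 : ℝ) ^ (N - i) = 1 - (1 / 2) ^ N := by
        intro N
        induction N with
        | zero => simp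
        | succ N ih =>
          rw [Finset.sum_range_succ, Nat.add_sub_cancel_left, pow_one]
          have : ∑ i ∈ Finset.range N, (1 / 2 : ℝ) ^ (N + 1 - i) =
              (1 / 2) * ∑ i ∈ Finset.range N, (1 / 2 : ℝ) ^ (N - i) := by
            rw [Finset.mul_sum]
            refine Finset.sum_congr rfl fun i hi => ?_
            rw [Nat.sub_add_comm (Finset.mem_range.mp hi).le, pow_succ, mul_comm]
          rw [this, ih, pow_succ]
          ring
      rw [this]
      have : (0 : ℝ) ≤ (1 / 2) ^ N := by positivity
      linarith
    have h3 := norm_add_sq (𝕜 := ℂ) (∑ i ∈ Finset.range N, x i) (x N)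
    have h4 := (RCLike.re_le_norm (inner ℂ (∑ i ∈ Finset.range N, x i) (x N))).trans h2
    rw [Finset.sum_range_succ, h3]
    push_cast
    linarith

/-- Points have capacity zero in the critical space `H^(n/2)(ℝⁿ)`: the averages of many dilates of
a bump function are small there. -/
theorem exists_eventuallyEq_one_norm_ofSchwartz_lt (hn : 1 ≤ n) (q : EuclideanSpace ℝ (Fin n))
    {ε : ℝ} (hε : 0 < ε) :
    ∃ η : 𝓢(EuclideanSpace ℝ (Fin n), ℂ), η =ᶠ[nhds q] 1 ∧ ‖ofSchwartz n (n / 2 : ℝ) η‖ < ε := by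
  let b : ContDiffBump (0 : EuclideanSpace ℝ (Fin n)) := default
  let ψ := schwartzBump b
  obtain ⟨C, hC, hCb⟩ := exists_norm_inner_dyadicDilation_le hn q ψ
  obtain ⟨N, hN⟩ := exists_nat_gt (3 * C / ε ^ 2)
  have hN0 : (0 : ℝ) < N := lt_of_le_of_lt (by positivity) hN
  refine ⟨(N : ℂ)⁻¹ • ∑ i ∈ Finset.range N, dyadicDilation q i ψ, ?_, ?_⟩
  · have h1 : ∀ i ∈ Finset.range N, ∀ᶠ x in nhds q, dyadicDilation q i ψ x = 1 := by
      intro i _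
      have hcont : Filter.Tendsto (fun x : EuclideanSpace ℝ (Fin n) => (2 : ℝ) ^ i • (x - q))
          (nhds q) (nhds 0) := by
        have : Continuous fun x : EuclideanSpace ℝ (Fin n) => (2 : ℝ) ^ i • (x - q) := by fun_prop
        simpa using this.tendsto q
      filter_upwards [hcont.eventually b.eventuallyEq_one] with x hx
      rw [dyadicDilation_apply, schwartzBump_apply, hx]
      simp
    filter_upwards [(Finset.eventually_all _).mpr h1] with x hx
    have hNC : (N : ℂ) ≠ 0 := by exact_mod_cast hN0.ne'
    rw [smul_apply, sum_apply, Finset.sum_congr rfl hx]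
    simp [hNC]
  · have h2 := norm_sum_sq_le_of_norm_inner_le hC hCb N
    have h3 : ∑ i ∈ Finset.range N,
        (weightedFourier (n / 2 : ℝ) (dyadicDilation q i ψ)).toLp 2 volume =
        (weightedFourier (n / 2 : ℝ) (∑ i ∈ Finset.range N, dyadicDilation q i ψ)).toLp 2 := by
      simp only [← SchwartzMap.toLpCLM_apply (𝕜 := ℂ), ← map_sum]
    rw [h3, ← norm_ofSchwartz] at h2
    rw [map_smul, norm_smul, norm_inv, Complex.norm_natCast, inv_mul_lt_iff₀ hN0]
    refine lt_of_pow_lt_pow_left₀ 2 (by positivity) (h2.trans_lt ?_)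
    rw [div_lt_iff₀ (by positivity)] at hN
    nlinarith

/-! ### A function of the critical space that vanishes on a dense open set -/

theorem exists_cutoff_norm_mul_lt (hn : 1 ≤ n) (w : 𝓢(EuclideanSpace ℝ (Fin n), ℂ))
    (q : EuclideanSpace ℝ (Fin n)) {ε : ℝ} (hε : 0 < ε) :
    ∃ (η : 𝓢(EuclideanSpace ℝ (Fin n), ℂ)) (ρ : ℝ), 0 < ρ ∧ ρ ≤ ε ∧
      (∀ x ∈ Metric.ball q ρ, η x = 1) ∧
      ‖ofSchwartz n (n / 2 : ℝ) (SchwartzMap.pairing (ContinuousLinearMap.mul ℂ ℂ) w η)‖ ≤ ε := by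
  obtain ⟨C, hC, hCb⟩ := exists_norm_ofSchwartz_mul_le (t := (n / 2 : ℝ)) (by positivity) w
  obtain ⟨η, hη, hlt⟩ := exists_eventuallyEq_one_norm_ofSchwartz_lt hn q
    (ε := ε / (C + 1)) (by positivity)
  obtain ⟨r, hr, hball⟩ := Metric.eventually_nhds_iff_ball.mp hη
  refine ⟨η, min r ε, lt_min hr hε, min_le_right _ _, fun x hx => ?_, ?_⟩
  · exact hball x (Metric.ball_subset_ball (min_le_left _ _) hx)
  · refine (hCb η).trans ?_
    rw [lt_div_iff₀ (by positivity)] at hlt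
    nlinarith [norm_nonneg (ofSchwartz n (n / 2 : ℝ) η)]

/-- Cutting a Schwartz function off near the points `q 0, q 1, …`, one after the other, with
prescribed bounds for the radii and for the changes in the critical norm. -/
theorem exists_seq_vanishing_near (hn : 1 ≤ n) (w₀ : 𝓢(EuclideanSpace ℝ (Fin n), ℂ))
    (q : ℕ → EuclideanSpace ℝ (Fin n)) {ε : ℕ → ℝ} (hε : ∀ k, 0 < ε k) :
    ∃ (w : ℕ → 𝓢(EuclideanSpace ℝ (Fin n), ℂ)) (ρ : ℕ → ℝ), w 0 = w₀ ∧
      (∀ k, 0 < ρ k) ∧ (∀ k, ρ k ≤ ε k) ∧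
      (∀ k, ‖ofSchwartz n (n / 2 : ℝ) (w (k + 1) - w k)‖ ≤ ε k) ∧
      (∀ k l x, k ≤ l → w k x = 0 → w l x = 0) ∧
      ∀ k, ∀ x ∈ Metric.ball (q k) (ρ k), w (k + 1) x = 0 := by
  choose η r hr hrε h1 hη using fun (w : 𝓢(EuclideanSpace ℝ (Fin n), ℂ)) (k : ℕ) =>
    exists_cutoff_norm_mul_lt hn w (q k) (hε k)
  let w : ℕ → 𝓢(EuclideanSpace ℝ (Fin n), ℂ) := fun k => Nat.rec w₀ (fun k w =>
    w - SchwartzMap.pairing (ContinuousLinearMap.mul ℂ ℂ) w (η w k)) k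
  have hw : ∀ k, w (k + 1) =
    w k - SchwartzMap.pairing (ContinuousLinearMap.mul ℂ ℂ) (w k) (η (w k) k) := fun k => rfl
  have hwx : ∀ k x, w (k + 1) x = w k x - w k x * η (w k) k x := fun k x => by
    rw [hw, sub_apply, SchwartzMap.pairing_apply_apply]
    rfl
  refine ⟨w, fun k => r (w k) k, rfl, fun k => hr _ _, fun k => hrε _ _, fun k => ?_,
    fun k l x hkl h => ?_, fun k x hx => ?_⟩
  · rw [hw, sub_sub_cancel_left, map_neg, norm_neg]
    exact hη _ _
  · induction l, hkl using Nat.le_induction with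
    | base => exact h
    | succ l _ ih => rw [hwx, ih, zero_mul, sub_zero]
  · rw [hwx, h1 _ _ x hx, mul_one, sub_self]

/-- There are dense open sets of small measure in which the test functions are not dense in
`H^s(ℝⁿ)` for any `s ≥ -n/2`: the complement carries a nonzero element of `H^(n/2)(ℝⁿ)`, obtained
from `φ₀` by cutting off near a dense sequence of points. -/
theorem exists_dense_isOpen_notMem_tildeSpace (hn : 1 ≤ n)
    {φ₀ : 𝓢(EuclideanSpace ℝ (Fin n), ℂ)} (hφ₀ : φ₀ ≠ 0) {α : ℝ} (hα : 0 < α) :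
    ∃ U : Set (EuclideanSpace ℝ (Fin n)), IsOpen U ∧ Dense U ∧ volume U ≤ ENNReal.ofReal α ∧
      ∀ Ω : Set (EuclideanSpace ℝ (Fin n)), Ω ∩ tsupport φ₀ ⊆ U → ∀ s : ℝ, -(n : ℝ) / 2 ≤ s →
        ofSchwartz n s φ₀ ∉ tildeSpace s Ω := by
  set V := volume.real (Metric.ball (0 : EuclideanSpace ℝ (Fin n)) 1)
  set P := ‖ofSchwartz n (-(n / 2) : ℝ) φ₀‖
  have hN : 0 < ‖φ₀.toLp 2 volume‖ := by
    rw [norm_pos_iff]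
    intro h
    refine hφ₀ (SchwartzMap.injective_toLp 2 volume (h.trans ?_))
    exact (map_zero (SchwartzMap.toLpCLM ℂ ℂ 2 volume)).symm
  -- the total budget for the radii and for the changes in norm
  obtain ⟨a, ha, ha1, haV, haP⟩ : ∃ a : ℝ, 0 < a ∧ a ≤ 1 ∧ a * V ≤ α ∧
      a * P ≤ ‖φ₀.toLp 2 volume‖ ^ 2 / 2 := by
    have hV : 0 ≤ V := measureReal_nonneg
    have hP : 0 ≤ P := norm_nonneg _
    refine ⟨min 1 (min (α / (V + 1)) (‖φ₀.toLp 2 volume‖ ^ 2 / 2 / (P + 1))), by positivity,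
      min_le_left _ _, ?_, ?_⟩
    · have h : min 1 (min (α / (V + 1)) (‖φ₀.toLp 2 volume‖ ^ 2 / 2 / (P + 1))) ≤ α / (V + 1) :=
        (min_le_right _ _).trans (min_le_left _ _)
      refine (mul_le_mul_of_nonneg_right h hV).trans ?_
      rw [div_mul_eq_mul_div, div_le_iff₀ (by positivity)]
      nlinarith
    · have h : min 1 (min (α / (V + 1)) (‖φ₀.toLp 2 volume‖ ^ 2 / 2 / (P + 1))) ≤
          ‖φ₀.toLp 2 volume‖ ^ 2 / 2 / (P + 1) := (min_le_right _ _).trans (min_le_right _ _)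
      refine (mul_le_mul_of_nonneg_right h hP).trans ?_
      rw [div_mul_eq_mul_div, div_le_iff₀ (by positivity)]
      nlinarith [sq_nonneg ‖φ₀.toLp 2 volume‖]
  let ε : ℕ → ℝ := fun k => a * (1 / 2) ^ (k + 1)
  have hε : ∀ k, 0 < ε k := fun k => by positivity
  have hεsum : HasSum ε a := by
    have h := hasSum_geometric_two.mul_left (a / 2)
    rw [div_mul_cancel₀ a two_ne_zero] at h
    refine h.congr_fun ?_
    intro k
    simp only [ε, pow_succ]
    ring
  obtain ⟨w, ρ, hw0, hρ, hρε, hdiff, hmono, hvan⟩ :=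
    exists_seq_vanishing_near hn φ₀ (TopologicalSpace.denseSeq (EuclideanSpace ℝ (Fin n))) hε
  set q := TopologicalSpace.denseSeq (EuclideanSpace ℝ (Fin n))
  have hnorm : ∀ k, ‖ofSchwartz n (n / 2 : ℝ) (w k - φ₀)‖ ≤ a := by
    intro k
    have h1 : w k - φ₀ = ∑ i ∈ Finset.range k, (w (i + 1) - w i) := by
      rw [Finset.sum_range_sub, hw0]
    rw [h1, map_sum]
    refine (norm_sum_le_of_le _ fun i _ => hdiff i).trans ?_
    exact hεsum.summable.sum_le_tsum _ (fun i _ => (hε i).le) |>.trans_eq hεsum.tsum_eq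
  refine ⟨⋃ k, Metric.ball (q k) (ρ k), isOpen_iUnion fun k => Metric.isOpen_ball, ?_, ?_, ?_⟩
  · refine (TopologicalSpace.denseRange_denseSeq (EuclideanSpace ℝ (Fin n))).mono ?_
    rintro _ ⟨k, rfl⟩
    exact Set.mem_iUnion.mpr ⟨k, Metric.mem_ball_self (hρ k)⟩
  · have hball : ∀ k, volume (Metric.ball (q k) (ρ k)) ≤ ENNReal.ofReal (ε k * V) := by
      intro k
      have hρ1 : ρ k ≤ 1 := by
        refine (hρε k).trans ?_
        calc ε k ≤ 1 * 1 := by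
              refine mul_le_mul ha1 ?_ (by positivity) zero_le_one
              exact pow_le_one₀ (by norm_num) (by norm_num)
          _ = 1 := one_mul 1
      have : Nonempty (Fin n) := ⟨⟨0, hn⟩⟩
      rw [Measure.addHaar_ball _ _ (hρ k).le, finrank_euclideanSpace_fin,
        ENNReal.ofReal_mul (hε k).le, ofReal_measureReal measure_ball_lt_top.ne]
      gcongr
      exact (pow_le_of_le_one (hρ k).le hρ1 (by omega)).trans (hρε k)
    calc _ ≤ ∑' k, volume (Metric.ball (q k) (ρ k)) := measure_iUnion_le _
      _ ≤ ∑' k, ENNReal.ofReal (ε k * V) := ENNReal.tsum_le_tsum hball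
      _ = ENNReal.ofReal (a * V) := by
        rw [← ENNReal.ofReal_tsum_of_nonneg
          (fun k => mul_nonneg (hε k).le measureReal_nonneg) (hεsum.mul_right V).summable,
          (hεsum.mul_right V).tsum_eq]
      _ ≤ _ := ENNReal.ofReal_le_ofReal haV
  · intro Ω hΩ s hs
    let ℓ : ℕ → 𝓢(EuclideanSpace ℝ (Fin n), ℂ) →ₗ[ℂ] ℂ := fun k =>
      (innerSL ℂ ((w k).toLp 2 volume)).toLinearMap ∘ₗ
        (SchwartzMap.toLpCLM ℂ ℂ 2 volume).toLinearMap
    have hℓ : ∀ k φ, ℓ k φ = inner ℂ ((w k).toLp 2 volume) (φ.toLp 2 volume) := fun k φ => rfl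
    refine ofSchwartz_notMem_tildeSpace ℓ (C := ‖ofSchwartz n (n / 2 : ℝ) φ₀‖ + a)
      (δ := ‖φ₀.toLp 2 volume‖ ^ 2 / 2) (fun k φ => ?_) (fun φ hc hφ => ?_) (by positivity)
      fun k => ?_
    · rw [hℓ]
      refine (norm_inner_toLp_le (t := (n / 2 : ℝ)) (neg_div 2 (n : ℝ) ▸ hs) (w k) φ).trans ?_
      gcongr
      have : w k = φ₀ + (w k - φ₀) := by abel
      rw [this, map_add]
      exact (norm_add_le _ _).trans (by gcongr; exact hnorm k)
    · -- finitely many of the balls cover the common support of `φ` and `φ₀`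
      have hK : IsCompact (tsupport φ ∩ tsupport φ₀) :=
        hc.isCompact.inter_right (isClosed_tsupport _)
      obtain ⟨T, hT⟩ := hK.elim_finite_subcover _ (fun k => Metric.isOpen_ball)
        ((Set.inter_subset_inter_left _ hφ).trans hΩ)
      filter_upwards [Filter.eventually_gt_atTop (T.sup id)] with k hk
      rw [hℓ, SchwartzMap.inner_toL2_toL2_eq _ _ volume]
      refine integral_eq_zero_of_ae (ae_of_all _ fun x => ?_)
      by_cases hx : x ∈ tsupport φ
      · have hwx : w k x = 0 := by
          by_cases hx0 : x ∈ tsupport φ₀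
          · obtain ⟨i, hi, hxi⟩ := Set.mem_iUnion₂.mp (hT ⟨hx, hx0⟩)
            refine hmono (i + 1) k x ?_ (hvan i x hxi)
            exact Nat.succ_le_of_lt (lt_of_le_of_lt (Finset.le_sup (f := id) hi) hk)
          · refine hmono 0 k x (Nat.zero_le k) ?_
            rw [hw0]
            exact image_eq_zero_of_notMem_tsupport hx0
        simp [hwx]
      · simp [image_eq_zero_of_notMem_tsupport hx]
    · -- the pairing of `φ₀` with itself dominates the one with the total change
      have h1 : ℓ k φ₀ = inner ℂ (φ₀.toLp 2 volume) (φ₀.toLp 2 volume) +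
          inner ℂ ((w k - φ₀).toLp 2 volume) (φ₀.toLp 2 volume) := by
        rw [hℓ, ← inner_add_left]
        congr 1
        simp only [← SchwartzMap.toLpCLM_apply (𝕜 := ℂ), ← map_add]
        congr 1
        abel
      have h2 : ‖inner ℂ ((w k - φ₀).toLp 2 volume) (φ₀.toLp 2 volume)‖ ≤ a * P :=
        (norm_inner_toLp_le (t := (n / 2 : ℝ)) le_rfl _ _).trans (by gcongr; exact hnorm k)
      have h3 : ‖inner ℂ (φ₀.toLp 2 volume) (φ₀.toLp 2 volume)‖ = ‖φ₀.toLp 2 volume‖ ^ 2 := by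
        rw [inner_self_eq_norm_sq_to_K]
        simp
      have h4 := norm_sub_le_norm_add (inner ℂ (φ₀.toLp 2 volume) (φ₀.toLp 2 volume))
        (inner ℂ ((w k - φ₀).toLp 2 volume) (φ₀.toLp 2 volume))
      rw [← h1, h3] at h4
      linarith

/-! ### A null set that is not removable for any positive order -/

/-- The `k`-th stage of the construction of a null set: the points of the unit cube for which the
binary digits number `(l + 1) ^ 2`, `l < k`, of the coordinate `i₀` vanish. The digit number `m` of
`y ∈ [0, 1)` is the parity of `⌊2 ^ m y⌋`. -/
def cantorStage (i₀ : Fin n) (k : ℕ) : Set (EuclideanSpace ℝ (Fin n)) :=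
  {x | (∀ i, ⌊x i⌋ = 0) ∧ ∀ l < k, Even ⌊(2 : ℝ) ^ ((l + 1) ^ 2) * x i₀⌋}

/-- A closed set containing `cantorStage i₀ k`: the evenness of `⌊y⌋` is relaxed to
`0 ≤ sin (π y)`. -/
def closedCantorStage (i₀ : Fin n) (k : ℕ) : Set (EuclideanSpace ℝ (Fin n)) :=
  {x | (∀ i, x i ∈ Set.Icc (0 : ℝ) 1) ∧
    ∀ l < k, 0 ≤ Real.sin (Real.pi * ((2 : ℝ) ^ ((l + 1) ^ 2) * x i₀))}

theorem sin_pi_mul_nonneg_of_even_floor {y : ℝ} (h : Even ⌊y⌋) : 0 ≤ Real.sin (Real.pi * y) := by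
  obtain ⟨r, hr⟩ := h
  have h1 : Real.pi * y = Real.pi * Int.fract y + r * (2 * Real.pi) := by
    rw [← Int.self_sub_floor, hr]
    push_cast
    ring
  rw [h1, Real.sin_add_int_mul_two_pi]
  refine Real.sin_nonneg_of_nonneg_of_le_pi (by positivity) ?_
  exact mul_le_of_le_one_right Real.pi_pos.le (Int.fract_lt_one y).le

theorem even_floor_or_eq_floor_of_sin_pi_mul_nonneg {y : ℝ} (h : 0 ≤ Real.sin (Real.pi * y)) :
    Even ⌊y⌋ ∨ y = ⌊y⌋ := by
  by_contra! hcon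
  obtain ⟨hodd, hne⟩ := hcon
  rw [Int.not_even_iff_odd] at hodd
  obtain ⟨r, hr⟩ := hodd
  have h1 : Real.pi * y = Real.pi * Int.fract y + Real.pi + r * (2 * Real.pi) := by
    rw [← Int.self_sub_floor, hr]
    push_cast
    ring
  have hfr : 0 < Int.fract y := by
    refine lt_of_le_of_ne (Int.fract_nonneg y) fun h0 => hne ?_
    rw [← Int.self_sub_floor] at h0
    linarith
  rw [h1, Real.sin_add_int_mul_two_pi, Real.sin_add_pi] at h
  have := Real.sin_pos_of_pos_of_lt_pi (x := Real.pi * Int.fract y) (by positivity)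
    (mul_lt_of_lt_one_right Real.pi_pos (Int.fract_lt_one y))
  linarith

theorem cantorStage_subset_closedCantorStage (i₀ : Fin n) (k : ℕ) :
    cantorStage i₀ k ⊆ closedCantorStage i₀ k := by
  rintro x ⟨hx, hx'⟩
  refine ⟨fun i => ?_, fun l hl => sin_pi_mul_nonneg_of_even_floor (hx' l hl)⟩
  have := Int.floor_eq_zero_iff.mp (hx i)
  exact ⟨this.1, this.2.le⟩

theorem cantorStage_antitone (i₀ : Fin n) : Antitone (cantorStage i₀) :=
  fun _ _ h _ hx => ⟨hx.1, fun l hl => hx.2 l (hl.trans_le h)⟩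

theorem closedCantorStage_antitone (i₀ : Fin n) : Antitone (closedCantorStage i₀) :=
  fun _ _ h _ hx => ⟨hx.1, fun l hl => hx.2 l (hl.trans_le h)⟩

theorem isClosed_closedCantorStage (i₀ : Fin n) (k : ℕ) : IsClosed (closedCantorStage i₀ k) := by
  have h : closedCantorStage i₀ k = (⋂ i, {x | x i ∈ Set.Icc (0 : ℝ) 1}) ∩
      ⋂ l, ⋂ (_ : l < k), {x | 0 ≤ Real.sin (Real.pi * ((2 : ℝ) ^ ((l + 1) ^ 2) * x i₀))} := by
    ext x
    simp [closedCantorStage]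
  rw [h]
  refine (isClosed_iInter fun i => isClosed_Icc.preimage (by fun_prop)).inter
    (isClosed_iInter fun l => isClosed_iInter fun _ => isClosed_le (by fun_prop) (by fun_prop))

theorem isCompact_closedCantorStage (i₀ : Fin n) (k : ℕ) :
    IsCompact (closedCantorStage i₀ k) := by
  have h : IsCompact ((EuclideanSpace.equiv (Fin n) ℝ).toHomeomorph ⁻¹'
      Set.pi Set.univ fun _ => Set.Icc (0 : ℝ) 1) :=
    (Homeomorph.isCompact_preimage _).mpr (isCompact_univ_pi fun _ => isCompact_Icc)
  refine h.of_isClosed_subset (isClosed_closedCantorStage i₀ k) fun x hx => ?_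
  exact fun i _ => hx.1 i

theorem measurableSet_cantorStage (i₀ : Fin n) (k : ℕ) : MeasurableSet (cantorStage i₀ k) := by
  have h : cantorStage i₀ k = (⋂ i, {x | ⌊x i⌋ ∈ ({0} : Set ℤ)}) ∩
      ⋂ l, ⋂ (_ : l < k), {x | ⌊(2 : ℝ) ^ ((l + 1) ^ 2) * x i₀⌋ ∈ {z : ℤ | Even z}} := by
    ext x
    simp [cantorStage]
  rw [h]
  refine (MeasurableSet.iInter fun i => ?_).inter
    (MeasurableSet.iInter fun l => MeasurableSet.iInter fun _ => ?_)
  · exact measurableSet_preimage (Measurable.floor (by fun_prop)) (MeasurableSet.of_discrete)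
  · exact measurableSet_preimage (Measurable.floor (by fun_prop)) (MeasurableSet.of_discrete)

theorem volume_cantorStage_zero (i₀ : Fin n) : volume (cantorStage i₀ 0) = 1 := by
  have h : cantorStage i₀ 0 = (@WithLp.ofLp 2 (Fin n → ℝ)) ⁻¹'
      Set.pi Set.univ fun _ => Set.Ico (0 : ℝ) 1 := by
    ext x
    simp [cantorStage, Int.floor_eq_zero_iff]
  rw [h, (PiLp.volume_preserving_ofLp (Fin n)).measure_preimage
    (MeasurableSet.univ_pi fun _ => measurableSet_Ico).nullMeasurableSet, Real.volume_pi_Ico]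
  simp

theorem volume_coordinate_hyperplane (i : Fin n) (c : ℝ) :
    volume {x : EuclideanSpace ℝ (Fin n) | x i = c} = 0 := by
  have h : {x : EuclideanSpace ℝ (Fin n) | x i = c} =
    (@WithLp.ofLp 2 (Fin n → ℝ)) ⁻¹' {f | f i = c} := rfl
  rw [h, (PiLp.volume_preserving_ofLp (Fin n)).measure_preimage
    (measurableSet_eq_fun (by fun_prop) (by fun_prop)).nullMeasurableSet]
  exact Measure.pi_hyperplane (fun _ : Fin n => (volume : Measure ℝ)) i c

/-- Adding `2 ^ (-M)` to a number whose binary digit number `M` vanishes leaves the preceding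
digits unchanged. -/
theorem floor_two_pow_mul_add_eq {M m : ℕ} (hm : m < M) {y : ℝ} (h : Even ⌊(2 : ℝ) ^ M * y⌋) :
    ⌊(2 : ℝ) ^ m * (y + ((2 : ℝ) ^ M)⁻¹)⌋ = ⌊(2 : ℝ) ^ m * y⌋ := by
  obtain ⟨d, rfl⟩ := Nat.exists_eq_add_of_lt hm
  have key : ∀ z : ℝ, ⌊(2 : ℝ) ^ m * z⌋ = ⌊(2 : ℝ) ^ (m + d + 1) * z⌋ / 2 / (2 ^ d : ℕ) := by
    intro z
    have h2 : (2 : ℝ) ^ m * z = (2 : ℝ) ^ (m + d + 1) * z / (2 : ℕ) / (2 ^ d : ℕ) := by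
      push_cast
      field_simp
      ring
    rw [h2, Int.floor_div_natCast, Int.floor_div_natCast]
    rfl
  have h1 : (2 : ℝ) ^ (m + d + 1) * (y + ((2 : ℝ) ^ (m + d + 1))⁻¹) =
      (2 : ℝ) ^ (m + d + 1) * y + 1 := by
    rw [mul_add, mul_inv_cancel₀ (by positivity)]
  rw [key, key y, h1, Int.floor_add_one]
  obtain ⟨r, hr⟩ := h
  rw [hr]
  congr 1
  omega

/-- The translation by `2 ^ (-(k + 1) ^ 2)` in the direction `i₀` exchanges the half of the `k`-th
stage that is kept with the half that is removed. -/
theorem add_single_mem_diff_iff (i₀ : Fin n) (k : ℕ) (x : EuclideanSpace ℝ (Fin n)) :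
    x + EuclideanSpace.single i₀ ((2 : ℝ) ^ ((k + 1) ^ 2))⁻¹ ∈
      cantorStage i₀ k \ cantorStage i₀ (k + 1) ↔ x ∈ cantorStage i₀ (k + 1) := by
  set M := (k + 1) ^ 2 with hM
  set x' := x + EuclideanSpace.single i₀ ((2 : ℝ) ^ M)⁻¹
  have hx'0 : x' i₀ = x i₀ + ((2 : ℝ) ^ M)⁻¹ := by simp [x']
  have hx' : ∀ i, i ≠ i₀ → x' i = x i := fun i hi => by simp [x', hi]
  have hsucc : ∀ z, z ∈ cantorStage i₀ (k + 1) ↔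
      z ∈ cantorStage i₀ k ∧ Even ⌊(2 : ℝ) ^ M * z i₀⌋ := by
    intro z
    simp only [cantorStage, Set.mem_ofPred_eq, Nat.lt_succ_iff_lt_or_eq, and_assoc, or_imp,
      forall_and, forall_eq, hM]
  have hfl : ⌊(2 : ℝ) ^ M * x' i₀⌋ = ⌊(2 : ℝ) ^ M * x i₀⌋ + 1 := by
    rw [hx'0, mul_add, mul_inv_cancel₀ (by positivity), Int.floor_add_one]
  have hpar : Even ⌊(2 : ℝ) ^ M * x' i₀⌋ ↔ ¬ Even ⌊(2 : ℝ) ^ M * x i₀⌋ := by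
    rw [hfl, Int.even_add_one]
  have hstage : Even ⌊(2 : ℝ) ^ M * x i₀⌋ → (x' ∈ cantorStage i₀ k ↔ x ∈ cantorStage i₀ k) := by
    intro he
    have h0 : ∀ i, ⌊x' i⌋ = ⌊x i⌋ := by
      intro i
      by_cases hi : i = i₀
      · subst hi
        have := floor_two_pow_mul_add_eq (m := 0) (M := M) (by positivity) he
        rw [hx'0]
        simpa using this
      · rw [hx' i hi]
    have h1 : ∀ l < k, ⌊(2 : ℝ) ^ ((l + 1) ^ 2) * x' i₀⌋ = ⌊(2 : ℝ) ^ ((l + 1) ^ 2) * x i₀⌋ := by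
      intro l hl
      rw [hx'0]
      exact floor_two_pow_mul_add_eq (Nat.pow_lt_pow_left (by omega) two_ne_zero) he
    constructor
    · rintro ⟨ha, hb⟩
      exact ⟨fun i => (h0 i).symm.trans (ha i), fun l hl => h1 l hl ▸ hb l hl⟩
    · rintro ⟨ha, hb⟩
      exact ⟨fun i => (h0 i).trans (ha i), fun l hl => (h1 l hl).symm ▸ hb l hl⟩
  rw [Set.mem_sdiff, hsucc, hsucc, hpar]
  tauto

theorem volume_cantorStage (i₀ : Fin n) (k : ℕ) :
    volume (cantorStage i₀ k) = (2⁻¹ : ENNReal) ^ k := by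
  induction k with
  | zero => rw [volume_cantorStage_zero, pow_zero]
  | succ k ih =>
    have hsub := cantorStage_antitone i₀ (Nat.le_succ k)
    have h1 : volume (cantorStage i₀ k \ cantorStage i₀ (k + 1)) =
        volume (cantorStage i₀ (k + 1)) := by
      rw [← measure_preimage_add_right volume
        (EuclideanSpace.single i₀ ((2 : ℝ) ^ ((k + 1) ^ 2))⁻¹)]
      congr 1
      ext x
      exact add_single_mem_diff_iff i₀ k x
    have h2 := measure_sdiff_add_inter (μ := volume) (cantorStage i₀ k)
      (measurableSet_cantorStage i₀ (k + 1))
    rw [Set.inter_eq_self_of_subset_right hsub, h1, ih, ← two_mul] at h2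
    rw [pow_succ, ← h2, mul_comm 2, mul_assoc, ENNReal.mul_inv_cancel two_ne_zero
      ENNReal.ofNat_ne_top, mul_one]

theorem volume_cantorStage_ne_top (i₀ : Fin n) (k : ℕ) : volume (cantorStage i₀ k) ≠ ⊤ := by
  rw [volume_cantorStage]
  exact ENNReal.pow_ne_top (by simp)

/-- A point of all the closed stages belongs to all the stages or to one of countably many
hyperplanes. -/
theorem volume_iInter_closedCantorStage (i₀ : Fin n) :
    volume (⋂ k, closedCantorStage i₀ k) = 0 := by
  have hsub : (⋂ k, closedCantorStage i₀ k) ⊆ (⋂ k, cantorStage i₀ k) ∪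
      ((⋃ i : Fin n, {x | x i = 1}) ∪
        ⋃ (l : ℕ) (z : ℤ), {x | x i₀ = z / (2 : ℝ) ^ ((l + 1) ^ 2)}) := by
    intro x hx
    rw [Set.mem_iInter] at hx
    by_contra hcon
    simp only [Set.mem_union, Set.mem_iUnion, Set.mem_iInter, Set.mem_ofPred_eq, not_or,
      not_exists] at hcon
    obtain ⟨h1, h2, h3⟩ := hcon
    refine h1 fun k => ⟨fun i => ?_, fun l hl => ?_⟩
    · have := (hx 0).1 i
      exact Int.floor_eq_zero_iff.mpr ⟨this.1, lt_of_le_of_ne this.2 (h2 i)⟩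
    · refine (even_floor_or_eq_floor_of_sin_pi_mul_nonneg ((hx k).2 l hl)).resolve_right ?_
      intro h
      refine h3 l ⌊(2 : ℝ) ^ ((l + 1) ^ 2) * x i₀⌋ ?_
      rw [← h, mul_div_cancel_left₀ _ (by positivity)]
  refine measure_mono_null hsub (measure_union_null ?_ (measure_union_null ?_ ?_))
  · refine le_antisymm ?_ (zero_le)
    have h : Filter.Tendsto (fun k : ℕ => (2⁻¹ : ENNReal) ^ k) Filter.atTop (nhds 0) :=
      ENNReal.tendsto_pow_atTop_nhds_zero_of_lt_one (by simp)
    refine ge_of_tendsto' h fun k => ?_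
    rw [← volume_cantorStage i₀ k]
    exact measure_mono (Set.iInter_subset _ k)
  · exact measure_iUnion_null fun i => volume_coordinate_hyperplane i 1
  · exact measure_iUnion_null fun l => measure_iUnion_null fun z =>
      volume_coordinate_hyperplane i₀ _

/-- The mean value of a function over `cantorStage i₀ k`. -/
noncomputable def cantorMean (i₀ : Fin n) (k : ℕ) :
    𝓢(EuclideanSpace ℝ (Fin n), ℂ) →ₗ[ℂ] ℂ :=
  (2 ^ k : ℂ) • ((innerSL ℂ (indicatorConstLp 2 (measurableSet_cantorStage i₀ k)
    (volume_cantorStage_ne_top i₀ k) (1 : ℂ))).toLinearMap ∘ₗ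
      (SchwartzMap.toLpCLM ℂ ℂ 2 volume).toLinearMap)

theorem inner_indicatorConstLp_toLp (i₀ : Fin n) (k : ℕ)
    (φ : 𝓢(EuclideanSpace ℝ (Fin n), ℂ)) :
    inner ℂ (indicatorConstLp 2 (measurableSet_cantorStage i₀ k)
      (volume_cantorStage_ne_top i₀ k) (1 : ℂ)) (φ.toLp 2 volume) =
      ∫ x in cantorStage i₀ k, φ x := by
  rw [L2.inner_indicatorConstLp_one]
  exact integral_congr_ae (ae_restrict_of_ae (φ.coeFn_toLp 2 volume))

theorem cantorMean_apply (i₀ : Fin n) (k : ℕ) (φ : 𝓢(EuclideanSpace ℝ (Fin n), ℂ)) :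
    cantorMean i₀ k φ = 2 ^ k * ∫ x in cantorStage i₀ k, φ x := by
  rw [← inner_indicatorConstLp_toLp]
  rfl

theorem norm_setIntegral_cantorStage_le (i₀ : Fin n) (k : ℕ)
    (φ : 𝓢(EuclideanSpace ℝ (Fin n), ℂ)) :
    ‖∫ x in cantorStage i₀ k, φ x‖ ≤ ‖φ.toLp 2 volume‖ := by
  rw [← inner_indicatorConstLp_toLp]
  refine (norm_inner_le_norm _ _).trans (mul_le_of_le_one_left (norm_nonneg _) ?_)
  refine norm_indicatorConstLp_le.trans ?_
  rw [norm_one, one_mul]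
  refine Real.rpow_le_one measureReal_nonneg ?_ (by positivity)
  rw [measureReal_def, volume_cantorStage]
  refine ENNReal.toReal_le_of_le_ofReal zero_le_one ?_
  rw [ENNReal.ofReal_one]
  exact pow_le_one₀ (by positivity) (by simp)

theorem cantorMean_of_eqOn_one (i₀ : Fin n) (k : ℕ) {φ : 𝓢(EuclideanSpace ℝ (Fin n), ℂ)}
    (hφ : ∀ x ∈ cantorStage i₀ k, φ x = 1) : cantorMean i₀ k φ = 1 := by
  rw [cantorMean_apply, setIntegral_congr_fun (measurableSet_cantorStage i₀ k) hφ,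
    setIntegral_const, measureReal_def, volume_cantorStage]
  simp

/-- Consecutive means differ by the mean of a difference of `φ` and a translate of `φ`. -/
theorem norm_cantorMean_succ_sub_le (i₀ : Fin n) (k : ℕ) {σ : ℝ} (hσ : 0 ≤ σ) (hσ1 : σ ≤ 1)
    (φ : 𝓢(EuclideanSpace ℝ (Fin n), ℂ)) :
    ‖cantorMean i₀ (k + 1) φ - cantorMean i₀ k φ‖ ≤
      2 ^ k * (2 * (2 * Real.pi * ((2 : ℝ) ^ ((k + 1) ^ 2))⁻¹) ^ σ) * ‖ofSchwartz n σ φ‖ := by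
  set h := EuclideanSpace.single i₀ ((2 : ℝ) ^ ((k + 1) ^ 2))⁻¹ with hh
  set A := cantorStage i₀ (k + 1) with hA
  have hsplit : ∫ x in cantorStage i₀ k, φ x = (∫ x in A, φ x) + ∫ x in A, φ (x + h) := by
    have h1 : ∫ x in cantorStage i₀ k \ A, φ x = ∫ x in A, φ (x + h) := by
      rw [← (measurePreserving_add_right volume h).setIntegral_preimage_emb
        (MeasurableEquiv.addRight h).measurableEmbedding]
      congr 2
      ext x
      exact add_single_mem_diff_iff i₀ k x
    have hsub := cantorStage_antitone i₀ (Nat.le_succ k)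
    rw [← h1, add_comm, ← setIntegral_union Set.disjoint_sdiff_left (measurableSet_cantorStage i₀ _)
      φ.integrable.integrableOn φ.integrable.integrableOn, Set.sdiff_union_of_subset hsub]
  have hdiff : cantorMean i₀ (k + 1) φ - cantorMean i₀ k φ =
      2 ^ k * ∫ x in A, (φ - SchwartzMap.compSubConstCLM ℂ (-h) φ) x := by
    have h2 : ∫ x in A, (φ - SchwartzMap.compSubConstCLM ℂ (-h) φ) x =
        (∫ x in A, φ x) - ∫ x in A, φ (x + h) := by
      have : ∀ x, SchwartzMap.compSubConstCLM ℂ (-h) φ x = φ (x + h) := fun x => by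
        rw [SchwartzMap.compSubConstCLM_apply, sub_neg_eq_add]
      simp only [sub_apply]
      rw [integral_sub φ.integrable.integrableOn (SchwartzMap.integrable _).integrableOn]
      simp only [this]
    rw [h2, cantorMean_apply, cantorMean_apply, hsplit, pow_succ]
    ring
  rw [hdiff, norm_mul, norm_pow, Complex.norm_ofNat, mul_assoc]
  gcongr
  refine (norm_setIntegral_cantorStage_le i₀ (k + 1) _).trans ?_
  refine (norm_toLp_sub_compSubConst_le hσ hσ1 φ (-h)).trans_eq ?_
  rw [norm_neg, hh, PiLp.norm_single, Real.norm_of_nonneg (by positivity)]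

theorem summable_two_pow_mul_rpow {σ : ℝ} (hσ : 0 < σ) :
    Summable fun k : ℕ =>
      (2 : ℝ) ^ k * (2 * (2 * Real.pi * ((2 : ℝ) ^ ((k + 1) ^ 2))⁻¹) ^ σ) := by
  -- the terms are equal to `C (2 r ^ (k + 1)) ^ (k + 1)` with `r = 2 ^ (-σ) < 1`
  set r : ℝ := ((2 : ℝ) ^ σ)⁻¹ with hr
  have hr0 : 0 < r := by positivity
  have hr1 : r < 1 := inv_lt_one_of_one_lt₀ (Real.one_lt_rpow one_lt_two hσ)
  have hterm : ∀ k : ℕ, (2 : ℝ) ^ k * (2 * (2 * Real.pi * ((2 : ℝ) ^ ((k + 1) ^ 2))⁻¹) ^ σ) =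
      (2 * Real.pi) ^ σ * (2 * r ^ (k + 1)) ^ (k + 1) := by
    intro k
    have h1 : (((2 : ℝ) ^ ((k + 1) ^ 2))⁻¹) ^ σ = r ^ ((k + 1) ^ 2) := by
      rw [hr, Real.inv_rpow (by positivity), inv_pow, ← Real.rpow_natCast, ← Real.rpow_natCast,
        ← Real.rpow_mul zero_le_two, ← Real.rpow_mul zero_le_two, mul_comm]
    rw [Real.mul_rpow (by positivity) (by positivity), h1, mul_pow, ← pow_mul, ← sq, pow_succ]
    ring
  simp only [hterm]
  refine Summable.mul_left _ ?_
  have hsmall : ∀ᶠ k : ℕ in Filter.atTop, r ^ (k + 1) < 1 / 4 :=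
    ((tendsto_pow_atTop_nhds_zero_of_lt_one hr0.le hr1).comp
      (Filter.tendsto_add_atTop_nat 1)).eventually_lt_const (by norm_num)
  refine Summable.of_norm_bounded_eventually_nat (g := fun k : ℕ => (1 / 2 : ℝ) ^ (k + 1)) ?_ ?_
  · exact (summable_nat_add_iff 1).mpr summable_geometric_two
  · filter_upwards [hsmall] with k hk
    rw [Real.norm_of_nonneg (by positivity)]
    exact pow_le_pow_left₀ (by positivity) (by linarith) _

/-- There is a compact null set whose removal from an open set is noticed by every space
`H^s(ℝⁿ)` with `s > 0`. -/
theorem exists_isCompact_volume_zero_notMem_tildeSpace (hn : 1 ≤ n) :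
    ∃ E : Set (EuclideanSpace ℝ (Fin n)), IsCompact E ∧ volume E = 0 ∧
      ∃ R : ℝ, 0 < R ∧ E ⊆ Metric.ball 0 R ∧ ∀ φ₀ : 𝓢(EuclideanSpace ℝ (Fin n), ℂ),
        (∀ x ∈ Metric.ball 0 R, φ₀ x = 1) → ∀ Ω : Set (EuclideanSpace ℝ (Fin n)), Disjoint Ω E →
          ∀ s : ℝ, 0 < s → ofSchwartz n s φ₀ ∉ tildeSpace s Ω := by
  let i₀ : Fin n := ⟨0, hn⟩
  obtain ⟨R, hR, hball⟩ :=
    (isCompact_closedCantorStage i₀ 0).isBounded.subset_ball_lt 0 0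
  refine ⟨⋂ k, closedCantorStage i₀ k, (isCompact_closedCantorStage i₀ 0).of_isClosed_subset
    (isClosed_iInter fun k => isClosed_closedCantorStage i₀ k) (Set.iInter_subset _ 0),
    volume_iInter_closedCantorStage i₀, R, hR, (Set.iInter_subset _ 0).trans hball, ?_⟩
  intro φ₀ hφ₀ Ω hΩ s hs
  -- orders above `1` are reduced to the order `1`, the limit of the estimate for translations
  have hσ : 0 < min s 1 := lt_min hs one_pos
  set c : ℕ → ℝ := fun k =>
    2 ^ k * (2 * (2 * Real.pi * ((2 : ℝ) ^ ((k + 1) ^ 2))⁻¹) ^ (min s 1))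
  have hc : Summable c := summable_two_pow_mul_rpow hσ
  have hc0 : ∀ k, 0 ≤ c k := fun k => by positivity
  refine ofSchwartz_notMem_tildeSpace (cantorMean i₀) (C := 1 + ∑' k, c k) (δ := 1)
    (fun k φ => ?_) (fun φ hcs hφ => ?_) one_pos fun k => ?_
  · have h1 : cantorMean i₀ k φ = cantorMean i₀ 0 φ +
        ∑ i ∈ Finset.range k, (cantorMean i₀ (i + 1) φ - cantorMean i₀ i φ) := by
      rw [Finset.sum_range_sub (fun i => cantorMean i₀ i φ)]
      ring
    have h2 : ‖cantorMean i₀ 0 φ‖ ≤ ‖ofSchwartz n s φ‖ := by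
      rw [cantorMean_apply, pow_zero, one_mul]
      exact (norm_setIntegral_cantorStage_le i₀ 0 φ).trans (norm_toLp_le_norm_ofSchwartz hs.le φ)
    have h3 : ∀ i ∈ Finset.range k, ‖cantorMean i₀ (i + 1) φ - cantorMean i₀ i φ‖ ≤
        c i * ‖ofSchwartz n s φ‖ := by
      intro i _
      refine (norm_cantorMean_succ_sub_le i₀ i hσ.le (min_le_right _ _) φ).trans ?_
      exact mul_le_mul_of_nonneg_left (norm_ofSchwartz_mono (min_le_left _ _) φ) (hc0 i)
    rw [h1, add_mul, one_mul]
    refine (norm_add_le _ _).trans (add_le_add h2 ?_)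
    refine (norm_sum_le_of_le _ h3).trans ?_
    rw [← Finset.sum_mul]
    gcongr
    exact hc.sum_le_tsum _ fun i _ => hc0 i
  · have hempty : tsupport φ ∩ ⋂ k, closedCantorStage i₀ k = ∅ :=
      (hΩ.mono_left hφ).inter_eq
    obtain ⟨k₀, hk₀⟩ := hcs.isCompact.elim_directed_family_closed _
      (fun k => isClosed_closedCantorStage i₀ k) hempty
      (closedCantorStage_antitone i₀).directed_ge
    filter_upwards [Filter.eventually_ge_atTop k₀] with k hk
    rw [cantorMean_apply, setIntegral_eq_zero_of_forall_eq_zero, mul_zero]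
    intro x hx
    refine image_eq_zero_of_notMem_tsupport fun hxs => ?_
    have : x ∈ tsupport φ ∩ closedCantorStage i₀ k₀ :=
      ⟨hxs, closedCantorStage_antitone i₀ hk (cantorStage_subset_closedCantorStage i₀ k hx)⟩
    rw [hk₀] at this
    exact this
  · rw [cantorMean_of_eqOn_one, norm_one]
    intro x hx
    refine hφ₀ x (hball ?_)
    exact closedCantorStage_antitone i₀ (Nat.zero_le k)
      (cantorStage_subset_closedCantorStage i₀ k hx)

end SobolevSpace

theorem theorem3p18 (n : ℕ) (hn : 1 ≤ n) :
    ∃ Ω : Set (EuclideanSpace ℝ (Fin n)), IsOpen Ω ∧ Bornology.IsBounded Ω ∧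
      (∀ s : ℝ, 0 < s →
        SobolevSpace.tildeSpace s Ω < SobolevSpace.circSpace s Ω ∧
        SobolevSpace.circSpace s Ω < SobolevSpace.supportedIn s (closure Ω)) ∧
      (∀ s : ℝ, -(n : ℝ) / 2 ≤ s →
        SobolevSpace.tildeSpace s Ω < SobolevSpace.supportedIn s (closure Ω)) := by
  open SobolevSpace in
  obtain ⟨E, hEc, hE0, R, hR, hER, hE⟩ := exists_isCompact_volume_zero_notMem_tildeSpace hn
  -- far enough from the origin for `closedBall c 1` to be disjoint from `ball 0 (R + 1)`
  let c : EuclideanSpace ℝ (Fin n) := EuclideanSpace.single ⟨0, hn⟩ (R + 3)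
  have hdisj : Disjoint (Metric.ball (0 : EuclideanSpace ℝ (Fin n)) (R + 1))
      (Metric.closedBall c 1) := by
    refine Metric.ball_disjoint_closedBall ?_
    rw [dist_zero_left, PiLp.norm_single, Real.norm_of_nonneg (by positivity)]
    linarith
  let b₀ : ContDiffBump (0 : EuclideanSpace ℝ (Fin n)) := ⟨R, R + 1, hR, by linarith⟩
  let b₁ : ContDiffBump c := ⟨1 / 2, 1, by norm_num, by norm_num⟩
  have hb₁ : ∀ x ∈ Metric.closedBall c (1 / 2), schwartzBump b₁ x = 1 := fun x hx => by
    rw [schwartzBump_apply, b₁.one_of_mem_closedBall hx, Complex.ofReal_one]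
  have hb₁t : tsupport (schwartzBump b₁) ⊆ Metric.closedBall c 1 :=
    closure_minimal (fun x hx => by
      by_contra hxc
      refine hx ?_
      rw [schwartzBump_apply, b₁.zero_of_le_dist (not_le.mp hxc).le, Complex.ofReal_zero])
      Metric.isClosed_closedBall
  have hb₁0 : schwartzBump b₁ ≠ 0 := fun h => by
    have h1 := hb₁ c (Metric.mem_closedBall_self (by norm_num))
    rw [h] at h1
    exact zero_ne_one h1
  have hvol : 0 < volume.real (Metric.closedBall c (1 / 2)) :=
    ENNReal.toReal_pos (Metric.measure_closedBall_pos volume c (by norm_num)).ne'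
      measure_closedBall_lt_top.ne
  obtain ⟨U, hUo, hUd, hUv, hU⟩ := exists_dense_isOpen_notMem_tildeSpace hn hb₁0 (half_pos hvol)
  have hUlt : volume U < volume (Metric.closedBall c (1 / 2)) := by
    refine hUv.trans_lt ?_
    rw [ENNReal.ofReal_lt_iff_lt_toReal (half_pos hvol).le measure_closedBall_lt_top.ne]
    exact half_lt_self hvol
  set Ω := (Metric.ball 0 (R + 1) \ E) ∪ (Metric.ball c 1 ∩ U) with hΩ
  have hΩE : Disjoint Ω E := by
    refine Set.disjoint_union_left.mpr ⟨Set.disjoint_sdiff_left, ?_⟩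
    refine (hdisj.mono (hER.trans (Metric.ball_subset_ball (by linarith)))
      (Set.inter_subset_left.trans Metric.ball_subset_closedBall)).symm
  have hΩU : Ω ∩ Metric.closedBall c 1 ⊆ U := by
    rintro x ⟨hx | hx, hxc⟩
    · exact absurd hxc (Set.disjoint_left.mp hdisj hx.1)
    · exact hx.2
  have hcl : Metric.closedBall c 1 ⊆ closure Ω := by
    rw [← closure_ball c one_ne_zero]
    refine closure_minimal ?_ isClosed_closure
    exact (hUd.open_subset_closure_inter Metric.isOpen_ball).trans
      (closure_mono Set.subset_union_right)
  have hmem : ∀ s : ℝ, ofSchwartz n s (schwartzBump b₁) ∈ supportedIn s (closure Ω) := fun s =>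
    ofSchwartz_mem_supportedIn isClosed_closure (hb₁t.trans hcl)
  refine ⟨Ω, ?_, ?_, fun s hs => ⟨?_, ?_⟩, fun s hs => ?_⟩
  · exact (Metric.isOpen_ball.sdiff hEc.isClosed).union (Metric.isOpen_ball.inter hUo)
  · exact (Metric.isBounded_ball.subset Set.sdiff_subset).union
      (Metric.isBounded_ball.subset Set.inter_subset_left)
  · refine SetLike.lt_iff_le_and_exists.mpr ⟨tildeSpace_le_circSpace hs.le Ω,
      ofSchwartz n s (schwartzBump b₀), ?_, hE _ (fun x hx => ?_) Ω hΩE s hs⟩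
    · rw [ofSchwartz_mem_circSpace_iff]
      filter_upwards [measure_eq_zero_iff_ae_notMem.mp hE0] with x hxE hxΩ
      have hx : R + 1 ≤ dist x 0 := by
        by_contra! h
        exact hxΩ (Or.inl ⟨h, hxE⟩)
      rw [schwartzBump_apply, b₀.zero_of_le_dist hx, Complex.ofReal_zero]
    · rw [schwartzBump_apply, b₀.one_of_mem_closedBall (Metric.ball_subset_closedBall hx),
        Complex.ofReal_one]
  · refine SetLike.lt_iff_le_and_exists.mpr ⟨circSpace_le_supportedIn s Ω, _, hmem s, ?_⟩
    rw [ofSchwartz_mem_circSpace_iff]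
    intro h
    -- otherwise almost every point of `closedBall c (1 / 2)` would belong to `U`
    refine hUlt.not_ge (measure_mono_ae ?_)
    filter_upwards [h] with x hx hxc
    by_contra hxU
    have hxc1 : x ∈ Metric.closedBall c 1 := Metric.closedBall_subset_closedBall (by norm_num) hxc
    have h0 := hx fun hxΩ => hxU (hΩU ⟨hxΩ, hxc1⟩)
    rw [hb₁ x hxc] at h0
    exact one_ne_zero h0
  · exact SetLike.lt_iff_le_and_exists.mpr ⟨tildeSpace_le_supportedIn s Ω, _, hmem s,
      hU Ω ((Set.inter_subset_inter_right _ hb₁t).trans hΩU) s hs⟩
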